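/- Let $3\le m<\infty$ and let $p:\Sigma\to\mathbb R^m$ be a $C^2$ immersion of an $(m-1)$-dimensional manifold $\Sigma$ (not necessarily injective), oriented by a unit normal field $\vec n$, and complete with respect to the intrinsic distance $d$ of the induced Riemannian metric (with $d=\infty$ between different components, if $\Sigma$ is not connected). Let $A$ be its second fundamental form, $\|A\|(x)$ the norm of $A$ at $x$, and let $x_0\in\Sigma$ be fixed. Let $a>0$ and assume (A2) $a<\rho$, where $\rho^{-1}$ is the supremum over $\Sigma$ of the absolute values of all principal curvatures ($\rho=\infty$ if this supremum is $0$); (A3) $\|A\|(x)\to0$ as $d(x,x_0)\to\infty$. Let $\Omega=\Sigma\times(-a,a)$ be the quantum layer of width $2a$ over $\Sigma$, with the (flat) Riemannian metric $G$ that is the pull-back of the Euclidean metric under $\Phi(x,u)=p(x)+u\,\vec n(x)$, and with the smooth structure in which $\Phi$ is a local diffeomorphism. Let $d\Omega$ and $\Delta$ be the volume element and the Laplacian of $G$, and put $$\sigma_{ess}=\sup_K\ \inf_{0\ne f\in C_0^\infty(\Omega\setminus K)}\frac{-\int_\Omega f\,\Delta f\,d\Omega}{\int_\Omega f^2\,d\Omega}\in[-\infty,\infty],$$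 where $K$ runs over all compact subsets of $\Omega$ (this is the bottom of the essential spectrum of the Dirichlet Laplacian on $\Omega$). Then $$\sigma_{ess}\ \ge\ \Big(\frac{\pi}{2a}\Big)^2 .$$ -/

import Mathlib

open Set Filter Topology MeasureTheory Manifold
open scoped ENNReal ContDiff

noncomputable section

/-- An oriented `C²` hypersurface immersed in `ℝ^m`: a `C²` immersion `p : S → ℝ^m` of an
`(m-1)`-dimensional manifold `S`, with the (`C¹`) unit normal field `ν` given by the orientation.
The immersion need not be injective. -/
structure OrientedHypersurface (m : ℕ) (S : Type*) [TopologicalSpace S]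
    [ChartedSpace (EuclideanSpace ℝ (Fin (m - 1))) S] where
  /-- the immersion -/
  p : S → EuclideanSpace ℝ (Fin m)
  /-- the unit normal field -/
  ν : S → EuclideanSpace ℝ (Fin m)
  contMDiff_p : ContMDiff (𝓡 (m - 1)) 𝓘(ℝ, EuclideanSpace ℝ (Fin m)) 2 p
  contMDiff_ν : ContMDiff (𝓡 (m - 1)) 𝓘(ℝ, EuclideanSpace ℝ (Fin m)) 1 ν
  injective_mfderiv : ∀ x,
    Function.Injective (mfderiv (𝓡 (m - 1)) 𝓘(ℝ, EuclideanSpace ℝ (Fin m)) p x)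
  norm_ν : ∀ x, ‖ν x‖ = 1
  normal : ∀ (x : S) (v : TangentSpace (𝓡 (m - 1)) x),
    inner ℝ (ν x) (mfderiv (𝓡 (m - 1)) 𝓘(ℝ, EuclideanSpace ℝ (Fin m)) p x v :
      EuclideanSpace ℝ (Fin m)) = 0

namespace OrientedHypersurface

variable {m : ℕ} {S : Type*} [TopologicalSpace S]
  [ChartedSpace (EuclideanSpace ℝ (Fin (m - 1))) S] (H : OrientedHypersurface m S)

/-- The differential of the immersion, `T_x S → ℝ^m`. -/
def dp (x : S) : TangentSpace (𝓡 (m - 1)) x →L[ℝ] EuclideanSpace ℝ (Fin m) :=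
  mfderiv (𝓡 (m - 1)) 𝓘(ℝ, EuclideanSpace ℝ (Fin m)) H.p x

/-- The differential of the unit normal field, `T_x S → ℝ^m`. -/
def dν (x : S) : TangentSpace (𝓡 (m - 1)) x →L[ℝ] EuclideanSpace ℝ (Fin m) :=
  mfderiv (𝓡 (m - 1)) 𝓘(ℝ, EuclideanSpace ℝ (Fin m)) H.ν x

/-- The intrinsic distance of the induced Riemannian metric `g(v, w) = ⟨dp v, dp w⟩`: the infimum
of the lengths of the `C¹` curves in `S` from `x` to `y` (it is `∞` if there is none). -/
def dist (x y : S) : ℝ≥0∞ :=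
  @riemannianEDist _ _ _ _ _ (𝓡 (m - 1)) S _ _ (fun z => ⟨fun v => ‖H.dp z v‖ₑ⟩) x y

/-- The hypersurface is complete for the intrinsic distance: every Cauchy sequence converges. -/
def IsComplete : Prop :=
  ∀ u : ℕ → S, (∀ ε > 0, ∃ N, ∀ i ≥ N, ∀ j ≥ N, H.dist (u i) (u j) < ε) →
    ∃ x, Tendsto (fun i => H.dist (u i) x) atTop (𝓝 0)

/-- The principal curvatures at `x`: the eigenvalues `k` of the Weingarten map `A`, which is
given by `dp (A v) = - dν v`. -/
def principalCurvatures (x : S) : Set ℝ :=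
  {k | ∃ v : TangentSpace (𝓡 (m - 1)) x, v ≠ 0 ∧ - H.dν x v = k • H.dp x v}

/-- The second fundamental form `A(v, w) = - ⟨dν v, dp w⟩`. -/
def secondFundamentalForm (x : S) (v w : TangentSpace (𝓡 (m - 1)) x) : ℝ :=
  - inner ℝ (H.dν x v) (H.dp x w)

/-- The norm `‖A‖(x)` of the second fundamental form at `x`, with respect to the induced
metric. -/
def normA (x : S) : ℝ :=
  sSup {r | ∃ v w : TangentSpace (𝓡 (m - 1)) x, ‖H.dp x v‖ ≤ 1 ∧ ‖H.dp x w‖ ≤ 1 ∧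
    r = |H.secondFundamentalForm x v w|}

/-- `a < ρ` where `1 / ρ` is the supremum over the hypersurface of the absolute values of all
principal curvatures (`ρ = ∞` if this supremum is `0`). -/
def BoundedWidth (a : ℝ) : Prop :=
  ∃ C : ℝ, a * C < 1 ∧ ∀ x, ∀ k ∈ H.principalCurvatures x, |k| ≤ C

/-- `‖A‖(x) → 0` as the intrinsic distance `d(x, x₀)` tends to infinity. -/
def AsymptoticallyFlat (x₀ : S) : Prop :=
  ∀ ε > 0, ∃ R : ℝ, ∀ x, ENNReal.ofReal R < H.dist x x₀ → H.normA x < ε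

/-- The quantum layer `Ω` of width `2a`: the manifold `S × (-a, a)`. Its metric `G` is the
pull-back of the Euclidean metric of `ℝ^m` by the layer map `Φ` below. -/
abbrev Layer (S : Type*) (a : ℝ) : Type _ := S × Ioo (-a) a

variable {a : ℝ}

/-- The layer map `Φ(x, u) = p(x) + u ν(x)`. -/
def Φ (z : Layer S a) : EuclideanSpace ℝ (Fin m) :=
  H.p z.1 + (z.2 : ℝ) • H.ν z.1

/-- The volume measure `dΩ` of the metric `G = Φ^* (Euclidean metric)`: on every open set on which
`Φ` is injective it is the pull-back of Lebesgue measure by `Φ`, and it is the smallest measure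
that dominates all these. (`Φ` itself need not be injective.) -/
def layerVolume [MeasurableSpace S] : Measure (Layer S a) :=
  ⨆ (U : Set (Layer S a)) (_ : IsOpen U ∧ InjOn H.Φ U),
    ((volume : Measure (EuclideanSpace ℝ (Fin m))).comap (fun z : U => H.Φ (z : Layer S a))).map
      Subtype.val

/-- `g` is a smooth expression of `f` near `z` in the local coordinates given by `Φ`. -/
def IsLocalExpr (f : Layer S a → ℝ) (z : Layer S a) (g : EuclideanSpace ℝ (Fin m) → ℝ) : Prop :=
  ContDiffAt ℝ ∞ g (H.Φ z) ∧ f =ᶠ[𝓝 z] g ∘ H.Φ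

/-- `f` is a `C^∞` function on the layer. The smooth structure is the one in which `Φ` is a local
diffeomorphism (the layer is a flat manifold, with `Φ` as a local isometry to `ℝ^m`); a `C²`
hypersurface provides no other. If `p` is smooth, it is the product structure. -/
def IsSmooth (f : Layer S a → ℝ) : Prop :=
  ∀ z, ∃ g, H.IsLocalExpr f z g

/-- The Laplacian of the metric `G` on the smooth functions on the layer: since `Φ` is a local
isometry, it is the Euclidean Laplacian in the local coordinates given by `Φ`. -/
def laplacian (f : Layer S a → ℝ) (z : Layer S a) : ℝ :=
  Laplacian.laplacian (Classical.epsilon (H.IsLocalExpr f z)) (H.Φ z)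

/-- `C₀^∞(Ω \ K)`: the smooth functions on the layer whose support is a compact subset of the
complement of `K`. -/
def testFunctions (K : Set (Layer S a)) : Set (Layer S a → ℝ) :=
  {f | H.IsSmooth f ∧ HasCompactSupport f ∧ tsupport f ⊆ Kᶜ}

/-- The Rayleigh quotient `(- ∫ f Δf dΩ) / ∫ f² dΩ`. -/
def rayleigh [MeasurableSpace S] (f : Layer S a → ℝ) : ℝ :=
  (- ∫ z, f z * H.laplacian f z ∂H.layerVolume) / ∫ z, f z ^ 2 ∂H.layerVolume

/-- `σ_ess`: the supremum over the compact subsets `K` of the layer of the infimum of the Rayleigh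
quotient over the nonzero functions in `C₀^∞(Ω \ K)`. -/
def σess [MeasurableSpace S] (a : ℝ) : EReal :=
  ⨆ (K : Set (Layer S a)) (_ : IsCompact K),
    ⨅ (f : Layer S a → ℝ) (_ : f ∈ H.testFunctions K ∧ f ≠ 0), (H.rayleigh f : EReal)

end OrientedHypersurface

end

/-! Integration by parts turns the numerator of the Rayleigh quotient into `∫ |∇f|²`, and `|∇f|² ≥
(∂f/∂u)²` because each fibre is mapped by `Φ` to a straight segment with unit velocity `ν`
(`integral_sq_layerFDeriv_le`). By Fubini (`lintegral_layerVolume_mono`) it is enough to compare `l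
∫ f²` with `∫ (∂f/∂u)²` on each fibre, weighted by the density `|det (1 + u • shape)|`, for every
`l` with `0 < l < (π / 2a)²`.

Let `C` be a compact set off which `‖A‖` is small; it exists because in a complete hypersurface
bounded sets lie in compact sets (`exists_isCompact_dist_le`). Over points outside `C` the density
is close to `1`, so the Wirtinger inequality with the sharp constant loses only a factor close to
`1`. Over `C` the density lies between two positive constants, because `a < ρ`. Removing `K = C ×
[-(a - δ), a - δ]` confines the test functions on these fibres to two intervals of length `δ`, where
the Poincaré constant is of order `δ⁻²` and, for small `δ`, beats the ratio of the two bounds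
(`exists_isCompact_forall_fibre`).

The remaining difficulty is that `Φ` is only `C¹` in the charts of `S` and need not be injective.
Smoothness, Laplacian and volume are therefore all handled through local inverses of `Φ`, and only
the Fubini argument uses charts of `S`. -/

noncomputable section

/-! ### Hopf–Rinow in length spaces -/

/-- The **Hopf–Rinow theorem** in a length space: if approximate intermediate points exist, then
the closed balls of a complete locally compact space are compact. -/
theorem isCompact_closedEBall_of_length {X : Type*} [EMetricSpace X] [CompleteSpace X]
    [LocallyCompactSpace X]
    (hlen : ∀ (x y : X) (r s : ℝ≥0∞), 0 < s → edist x y < r + s →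
      ∃ z, edist x z ≤ r ∧ edist z y < s) (x₀ : X) (R : ℝ) :
    IsCompact (Metric.closedEBall x₀ (ENNReal.ofReal R)) := by
  set s : Set ℝ := {r | IsCompact (Metric.closedEBall x₀ (ENNReal.ofReal r))} with hs
  have hmono : ∀ {r r' : ℝ}, r ≤ r' → r' ∈ s → r ∈ s := fun {r r'} h h' =>
    IsCompact.of_isClosed_subset h' Metric.isClosed_closedEBall
      (Metric.closedEBall_subset_closedEBall (ENNReal.ofReal_le_ofReal h))
  have h0 : (0 : ℝ) ∈ s := by
    have : Metric.closedEBall x₀ (ENNReal.ofReal 0) = {x₀} := by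
      ext y; simp
    simp only [hs, mem_ofPred_eq, this, isCompact_singleton]
  rcases le_total R 0 with hR | hR
  · exact hmono hR h0
  -- The set `s` of good radii is an interval, shown to be closed and open to the right. Closed: if
  -- `r'` is a good radius near `r`, the length property puts every point of the `r`-ball within
  -- `ε'` of the compact `r'`-ball, which has a finite `ε'`-net.
  have hclosed : IsClosed (s ∩ Icc 0 R) := by
    refine IsClosed.inter ?_ isClosed_Icc
    refine isClosed_of_closure_subset fun r hr => ?_
    refine TotallyBounded.isCompact_of_isClosed ?_ Metric.isClosed_closedEBall
    rw [EMetric.totallyBounded_iff]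
    intro ε hε
    obtain ⟨ε', hε', hε'2⟩ : ∃ ε' : ℝ, 0 < ε' ∧ ENNReal.ofReal ε' + ENNReal.ofReal ε' ≤ ε := by
      obtain ⟨δ, hδ, hδε⟩ := ENNReal.lt_iff_exists_real_btwn.1 (ENNReal.half_pos hε.ne')
      refine ⟨δ, ?_, ?_⟩
      · exact ENNReal.ofReal_pos.1 (lt_of_le_of_lt zero_le hδε.1)
      · calc _ ≤ ε / 2 + ε / 2 := add_le_add hδε.2.le hδε.2.le
          _ = ε := ENNReal.add_halves ε
    obtain ⟨r', hr', hd⟩ := Metric.mem_closure_iff.1 hr ε' hε'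
    rw [Real.dist_eq, abs_lt] at hd
    obtain ⟨t, ht, htc⟩ := (EMetric.totallyBounded_iff.1 hr'.totallyBounded)
      (ENNReal.ofReal ε') (ENNReal.ofReal_pos.2 hε')
    refine ⟨t, ht, fun y hy => ?_⟩
    rw [Metric.mem_closedEBall, edist_comm] at hy
    have hlt : edist x₀ y < ENNReal.ofReal r' + ENNReal.ofReal ε' := by
      rcases le_total 0 r' with h | h
      · rw [← ENNReal.ofReal_add h hε'.le]
        refine hy.trans_lt ((ENNReal.ofReal_lt_ofReal_iff (by linarith)).2 (by linarith))
      · rw [ENNReal.ofReal_of_nonpos h, zero_add]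
        refine hy.trans_lt ((ENNReal.ofReal_lt_ofReal_iff (by linarith)).2 (by linarith))
    obtain ⟨z, hz, hzy⟩ := hlen x₀ y _ _ (ENNReal.ofReal_pos.2 hε') hlt
    have hz' := htc (show z ∈ Metric.closedEBall x₀ (ENNReal.ofReal r') by
      rwa [Metric.mem_closedEBall, edist_comm])
    simp only [mem_iUnion, Metric.mem_eball, exists_prop] at hz' ⊢
    obtain ⟨w, hw, hzw⟩ := hz'
    refine ⟨w, hw, lt_of_le_of_lt (edist_triangle y z w) ?_⟩
    rw [edist_comm] at hzy
    exact (ENNReal.add_lt_add hzy hzw).trans_le hε'2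
  refine (hclosed.Icc_subset_of_forall_mem_nhdsGT_of_Icc_subset (a := 0) (b := R) ?_ ?_)
    (right_mem_Icc.2 hR)
  · exact h0
  intro r hr hsub
  have hrs : r ∈ s := hsub (right_mem_Icc.2 hr.1)
  -- Open to the right: a compact neighbourhood of the compact ball contains a `δ`-thickening of it,
  -- hence all slightly larger balls.
  obtain ⟨K, hK, hKs⟩ := exists_compact_superset (show IsCompact _ from hrs)
  obtain ⟨δ, hδ, hsubK⟩ := hrs.exists_thickening_subset_open isOpen_interior hKs
  have hmem : Ioo r (r + δ) ∈ 𝓝[>] r := Ioo_mem_nhdsGT (by linarith)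
  filter_upwards [hmem] with r' hr'
  refine IsCompact.of_isClosed_subset hK Metric.isClosed_closedEBall fun y hy => ?_
  refine interior_subset (hsubK ?_)
  rw [Metric.mem_closedEBall, edist_comm] at hy
  have hlt : edist x₀ y < ENNReal.ofReal r + ENNReal.ofReal δ := by
    rw [← ENNReal.ofReal_add hr.1 hδ.le]
    exact hy.trans_lt ((ENNReal.ofReal_lt_ofReal_iff (by linarith [hr.1])).2 hr'.2)
  obtain ⟨z, hz, hzy⟩ := hlen x₀ y _ _ (ENNReal.ofReal_pos.2 hδ) hlt
  rw [Metric.mem_thickening_iff_exists_edist_lt]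
  exact ⟨z, by rwa [Metric.mem_closedEBall, edist_comm], by rwa [edist_comm]⟩

open Bundle in
/-- Approximate intermediate points for the Riemannian distance. -/
theorem exists_riemannianEDist_le_and_lt {E H M : Type*} [NormedAddCommGroup E] [NormedSpace ℝ E]
    [TopologicalSpace H] {I : ModelWithCorners ℝ E H} [TopologicalSpace M] [ChartedSpace H M]
    [∀ x : M, ENorm (TangentSpace I x)] [∀ x : M, ENormSMulClass ℝ (TangentSpace I x)]
    {x y : M} {r s : ℝ≥0∞} (hs : 0 < s) (h : riemannianEDist I x y < r + s) :
    ∃ z, riemannianEDist I x z ≤ r ∧ riemannianEDist I z y < s := by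
  obtain ⟨γ, h0, h1, hγ, hlen⟩ := exists_lt_of_riemannianEDist_lt h
  set L : ℝ → ℝ≥0∞ := fun t => pathELength I γ 0 t with hL
  have hfin : ∫⁻ t in Icc (0:ℝ) 1, ‖mfderiv 𝓘(ℝ, ℝ) I γ t 1‖ₑ ≠ ⊤ := by
    rw [← pathELength_eq_lintegral_mfderiv_Icc]
    exact (hlen.trans_le le_top).ne
  have hadd : ∀ {t t'}, 0 ≤ t → t ≤ t' → L t' = L t + pathELength I γ t t' := fun ht htt' =>
    (pathELength_add ht htt').symm
  -- Arc length is continuous by absolute continuity of the integral, so the intermediate value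
  -- theorem finds a point at arc length exactly `r` from the start.
  have hmod : ∀ ε : ℝ≥0∞, ε ≠ 0 → ∃ δ > 0, ∀ t ∈ Icc (0:ℝ) 1, ∀ t' ∈ Icc (0:ℝ) 1, t ≤ t' →
      ENNReal.ofReal (t' - t) < δ → L t' ≤ L t + ε := by
    intro ε hε
    obtain ⟨δ, hδ, H⟩ := exists_pos_setLIntegral_lt_of_measure_lt hfin hε
    refine ⟨δ, hδ, fun t ht t' ht' htt' hlt => ?_⟩
    rw [hadd ht.1 htt']
    gcongr
    have := H (Icc t t') (by
      rw [Measure.restrict_apply measurableSet_Icc]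
      exact (measure_mono inter_subset_left).trans_lt (by rwa [Real.volume_Icc]))
    rw [Measure.restrict_restrict measurableSet_Icc,
      inter_eq_left.2 (Icc_subset_Icc ht.1 ht'.2)] at this
    rw [pathELength_eq_lintegral_mfderiv_Icc]
    exact this.le
  have hLmono : Monotone L := fun t t' h => pathELength_mono le_rfl h
  have hcont : ContinuousOn L (Icc 0 1) := by
    intro t ht
    refine (ENNReal.tendsto_nhds ?_).2 fun ε hε => ?_
    · refine ((hLmono ht.2).trans_lt (hlen.trans_le le_top)).ne
    obtain ⟨δ, hδ, H⟩ := hmod ε hε.ne'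
    have hnear : ∀ᶠ t' in 𝓝[Icc 0 1] t, ENNReal.ofReal |t' - t| < δ := by
      have : Tendsto (fun t' => ENNReal.ofReal |t' - t|) (𝓝[Icc 0 1] t) (𝓝 0) := by
        have : ContinuousWithinAt (fun t' => ENNReal.ofReal |t' - t|) (Icc 0 1) t :=
          (ENNReal.continuous_ofReal.comp (by fun_prop)).continuousWithinAt
        simpa [ContinuousWithinAt] using this
      exact this.eventually (gt_mem_nhds hδ)
    filter_upwards [hnear, self_mem_nhdsWithin] with t' hlt ht'
    rcases le_total t t' with h | h
    · refine ⟨tsub_le_self.trans (hLmono h), H t ht t' ht' h ?_⟩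
      rwa [abs_of_nonneg (by linarith)] at hlt
    · refine ⟨?_, (hLmono h).trans le_self_add⟩
      rw [tsub_le_iff_right]
      refine H t' ht' t ht h ?_
      rwa [abs_sub_comm, abs_of_nonneg (by linarith)] at hlt
  have hdist : ∀ t ∈ Icc (0:ℝ) 1, riemannianEDist I x (γ t) ≤ L t := fun t ht =>
    riemannianEDist_le_pathELength (hγ.mono (Icc_subset_Icc le_rfl ht.2)) h0 rfl ht.1
  have hdist' : ∀ t ∈ Icc (0:ℝ) 1, riemannianEDist I (γ t) y ≤ pathELength I γ t 1 := fun t ht =>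
    riemannianEDist_le_pathELength (hγ.mono (Icc_subset_Icc ht.1 le_rfl)) rfl h1 ht.2
  rcases le_total (L 1) r with hr | hr
  · refine ⟨y, ?_, by rwa [riemannianEDist_self]⟩
    rw [← h1]
    exact (hdist 1 (by simp)).trans hr
  · obtain ⟨t, ht, htr⟩ := intermediate_value_Icc zero_le_one hcont
      (show r ∈ Icc (L 0) (L 1) from ⟨by simp [hL], hr⟩)
    refine ⟨γ t, (hdist t ht).trans htr.le, (hdist' t ht).trans_lt ?_⟩
    have h2 : L 1 < r + s := hlen
    rw [hadd ht.1 ht.2, htr] at h2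
    exact lt_of_add_lt_add_left h2

/-! ### The induced Riemannian metric and compactness of bounded sets -/

namespace OrientedHypersurface

variable {m : ℕ} {S : Type*} [TopologicalSpace S]
  [ChartedSpace (EuclideanSpace ℝ (Fin (m - 1))) S] (H : OrientedHypersurface m S)

open Bundle

/-- The first fundamental form `⟨dp v, dp w⟩` as a bilinear form. -/
def metricForm (x : S) : TangentSpace (𝓡 (m - 1)) x →L[ℝ] TangentSpace (𝓡 (m - 1)) x →L[ℝ] ℝ :=
  letI A : EuclideanSpace ℝ (Fin (m - 1)) →L[ℝ] EuclideanSpace ℝ (Fin m) := H.dp x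
  ((innerSL ℝ).bilinearComp A A :
    EuclideanSpace ℝ (Fin (m - 1)) →L[ℝ] EuclideanSpace ℝ (Fin (m - 1)) →L[ℝ] ℝ)

theorem metricForm_apply (x : S) (v w : TangentSpace (𝓡 (m - 1)) x) :
    H.metricForm x v w = inner ℝ (H.dp x v) (H.dp x w) := rfl

/-- The induced Riemannian metric. -/
def inducedMetric [IsManifold (𝓡 (m - 1)) 2 S] :
    ContinuousRiemannianMetric (EuclideanSpace ℝ (Fin (m - 1)))
      (fun x : S => TangentSpace (𝓡 (m - 1)) x) where
  inner := H.metricForm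
  symm x v w := by
    rw [metricForm_apply, metricForm_apply, real_inner_comm]
  pos x v hv := by
    rw [metricForm_apply, real_inner_self_pos]
    intro h
    exact hv (H.injective_mfderiv x (h.trans (map_zero _).symm))
  isVonNBounded x := by
    let A : EuclideanSpace ℝ (Fin (m - 1)) →L[ℝ] EuclideanSpace ℝ (Fin m) := H.dp x
    have hA : Function.Injective A := H.injective_mfderiv x
    obtain ⟨K, hK, hAK⟩ := (A.toLinearMap).exists_antilipschitzWith (LinearMap.ker_eq_bot.2 hA)
    change Bornology.IsVonNBounded ℝ {v : EuclideanSpace ℝ (Fin (m - 1)) | inner ℝ (A v) (A v) < 1}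
    rw [NormedSpace.isVonNBounded_iff]
    refine (Metric.isBounded_closedBall (x := (0 : EuclideanSpace ℝ (Fin (m - 1)))) (r := K)).subset
      fun v hv => ?_
    rw [mem_ofPred_eq, real_inner_self_eq_norm_sq] at hv
    have h1 : ‖A v‖ ≤ 1 := by nlinarith [norm_nonneg (A v)]
    rw [mem_closedBall_zero_iff]
    have h2 := hAK.le_mul_dist v 0
    rw [map_zero, dist_zero_right, dist_zero_right] at h2
    refine h2.trans ?_
    have : ‖A.toLinearMap v‖ ≤ 1 := h1
    nlinarith [K.2]
  continuous := by
    rw [continuous_iff_continuousAt]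
    intro x₀
    rw [FiberBundle.continuousAt_totalSpace]
    refine ⟨continuousAt_id, ?_⟩
    -- In the trivialization at `x₀` the metric is the pull-back of the Euclidean inner product
    -- under `A x`, the differential of `p` in these coordinates, which is continuous because `p` is
    -- `C²`.
    set A : S → EuclideanSpace ℝ (Fin (m - 1)) →L[ℝ] EuclideanSpace ℝ (Fin m) :=
      inTangentCoordinates (𝓡 (m - 1)) 𝓘(ℝ, EuclideanSpace ℝ (Fin m)) id H.p
        (mfderiv (𝓡 (m - 1)) 𝓘(ℝ, EuclideanSpace ℝ (Fin m)) H.p) x₀ with hA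
    have hAc : ContinuousAt A x₀ :=
      ((H.contMDiff_p x₀).mfderiv_const (m := 1) (by norm_num)).continuousAt
    have hB : ContinuousAt (fun x => ((innerSL ℝ).bilinearComp (A x) (A x) :
        EuclideanSpace ℝ (Fin (m - 1)) →L[ℝ] EuclideanSpace ℝ (Fin (m - 1)) →L[ℝ] ℝ)) x₀ := by
      simp only [ContinuousLinearMap.bilinearComp]
      have hflip := fun (F G : Type) [NormedAddCommGroup F] [NormedSpace ℝ F] 
        [NormedAddCommGroup G] [NormedSpace ℝ G] =>
        (ContinuousLinearMap.flipₗᵢ ℝ F G ℝ).continuous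
      refine (hflip _ _).continuousAt.comp ?_
      refine ContinuousAt.clm_comp ?_ hAc
      refine (hflip _ _).continuousAt.comp ?_
      exact ContinuousAt.clm_comp continuousAt_const hAc
    refine hB.congr ?_
    have hmem : (chartAt (EuclideanSpace ℝ (Fin (m - 1))) x₀).source ∈ 𝓝 x₀ :=
      chart_source_mem_nhds _ x₀
    filter_upwards [hmem] with x hx
    rw [hom_trivializationAt_apply]
    ext v w
    rw [inCoordinates_apply_eq₂ (by simpa using hx) (by simpa using hx)
      (by simp)]
    have key : ∀ v, A x v = H.dp x ((trivializationAt (EuclideanSpace ℝ (Fin (m - 1)))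
        (TangentSpace (𝓡 (m - 1))) x₀).symm x v) := by
      intro v
      simp only [hA, inTangentCoordinates, ContinuousLinearMap.inCoordinates,
        TangentBundle.continuousLinearMapAt_model_space]
      exact congrArg (H.dp x) (Bundle.Trivialization.symmL_apply (R := ℝ) (trivializationAt
        (EuclideanSpace ℝ (Fin (m - 1))) (TangentSpace (𝓡 (m - 1))) x₀) (by simpa using hx) v)
    simp only [ContinuousLinearMap.bilinearComp_apply, key, metricForm_apply]
    simp


/-- The metric space structure of the induced metric has `H.dist` as its distance, and intermediate
points exist along almost minimizing curves, so Hopf–Rinow applies. Completeness enters the proof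
only here. -/
theorem exists_isCompact_dist_le [T2Space S] [IsManifold (𝓡 (m - 1)) 2 S] (hc : H.IsComplete)
    (x₀ : S) (R : ℝ) : ∃ K : Set S, IsCompact K ∧ ∀ x, H.dist x x₀ ≤ ENNReal.ofReal R → x ∈ K := by
  let : RiemannianBundle (fun x : S => TangentSpace (𝓡 (m - 1)) x) :=
    ⟨H.inducedMetric.toRiemannianMetric⟩
  have : LocallyCompactSpace S :=
    ChartedSpace.locallyCompactSpace (EuclideanSpace ℝ (Fin (m - 1))) S
  let : EMetricSpace S := EMetricSpace.ofRiemannianMetric (𝓡 (m - 1)) S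
  have hedist : ∀ x y : S, H.dist x y = edist x y := by
    intro x y
    change _ = riemannianEDist (𝓡 (m - 1)) x y
    unfold OrientedHypersurface.dist
    congr 1
    ext z
    congr 1
    ext v
    have hn : ‖v‖ = ‖H.dp z v‖ := by
      rw [norm_eq_sqrt_real_inner, norm_eq_sqrt_real_inner]
      rfl
    rw [← ofReal_norm]
    exact (congrArg ENNReal.ofReal hn.symm).trans (ofReal_norm v)
  have : CompleteSpace S := by
    refine EMetric.complete_of_cauchySeq_tendsto fun u hu => ?_
    rw [EMetric.cauchySeq_iff] at hu
    obtain ⟨x, hx⟩ := hc u (by simpa only [hedist] using hu)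
    refine ⟨x, ?_⟩
    rw [tendsto_iff_edist_tendsto_0]
    simpa only [hedist] using hx
  refine ⟨_, isCompact_closedEBall_of_length (fun x y r s hs h => ?_) x₀ R, fun x hx => ?_⟩
  · exact exists_riemannianEDist_le_and_lt hs h
  · rwa [Metric.mem_closedEBall, ← hedist]

end OrientedHypersurface

/-! ### Linear algebra of a tangent map together with a normal vector -/

section Frame

variable {V W : Type*} [NormedAddCommGroup V] [NormedSpace ℝ V] [NormedAddCommGroup W]
  [InnerProductSpace ℝ W]

/-- The linear map `(v, s) ↦ A v + s n`. -/
def frameMap (A : V →L[ℝ] W) (n : W) : V × ℝ →L[ℝ] W :=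
  A.coprod (ContinuousLinearMap.toSpanSingleton ℝ n)

@[simp]
theorem frameMap_apply (A : V →L[ℝ] W) (n : W) (z : V × ℝ) :
    frameMap A n z = A z.1 + z.2 • n := by
  simp [frameMap]

/-- The endomorphism of `W` that maps `A v + s n` to `B v`. -/
def shapeMap (A B : V →L[ℝ] W) (n : W) : W →L[ℝ] W :=
  (B ∘L ContinuousLinearMap.fst ℝ V ℝ) ∘L (frameMap A n).inverse

theorem frameMap_isInvertible [FiniteDimensional ℝ V] [FiniteDimensional ℝ W]
    (hdim : Module.finrank ℝ V + 1 = Module.finrank ℝ W) {A : V →L[ℝ] W} {n : W}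
    (hA : Function.Injective A) (hn : ‖n‖ = 1) (hAn : ∀ v, inner ℝ n (A v) = 0) :
    (frameMap A n).IsInvertible := by
  have hinj : Function.Injective (frameMap A n : V × ℝ →ₗ[ℝ] W) := by
    rw [← LinearMap.ker_eq_bot, LinearMap.ker_eq_bot']
    rintro ⟨v, s⟩ h
    have h' : A v + s • n = 0 := by simpa using h
    have hs : s = 0 := by
      have := congrArg (inner ℝ n) h'
      rw [inner_add_right, hAn, inner_smul_right, real_inner_self_eq_norm_sq, hn] at this
      simpa using this
    subst hs
    rw [zero_smul, add_zero] at h'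
    rw [Prod.mk_eq_zero]
    exact ⟨hA (h'.trans (map_zero A).symm), rfl⟩
  have hd : Module.finrank ℝ (V × ℝ) = Module.finrank ℝ W := by
    rw [Module.finrank_prod, Module.finrank_self, hdim]
  refine ⟨(LinearEquiv.ofInjectiveOfFinrankEq _ hinj hd).toContinuousLinearEquiv, ?_⟩
  ext z <;> simp [LinearEquiv.ofInjectiveOfFinrankEq]

theorem shapeMap_apply {A B : V →L[ℝ] W} {n : W} (h : (frameMap A n).IsInvertible) (v : V)
    (s : ℝ) : shapeMap A B n (A v + s • n) = B v := by
  obtain ⟨e, he⟩ := h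
  have h1 : A v + s • n = e (v, s) := by
    rw [← ContinuousLinearEquiv.coe_coe, he, frameMap_apply]
  rw [shapeMap, ← he, h1]
  simp

theorem exists_eq_frame {A : V →L[ℝ] W} {n : W} (h : (frameMap A n).IsInvertible) (w : W) :
    ∃ (v : V) (s : ℝ), w = A v + s • n := by
  obtain ⟨e, he⟩ := h
  refine ⟨(e.symm w).1, (e.symm w).2, ?_⟩
  rw [← frameMap_apply, ← he]
  simp

/-- The differential of `p + u ν` factors through that of `u = 0`, with a left factor that lives on
the ambient space. Its determinant needs no choice of coordinates. -/
theorem frameMap_add_smul {A B : V →L[ℝ] W} {n : W} (h : (frameMap A n).IsInvertible) (u : ℝ) :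
    frameMap (A + u • B) n = (1 + u • shapeMap A B n) ∘L frameMap A n := by
  refine ContinuousLinearMap.ext fun z => ?_
  simp only [frameMap_apply, ContinuousLinearMap.comp_apply, add_apply,
    smul_apply, one_apply_eq_self, shapeMap_apply h]
  abel

theorem frameMap_comp (A : V →L[ℝ] W) (C : V →L[ℝ] V) (n : W) :
    frameMap (A ∘L C) n = frameMap A n ∘L C.prodMap (ContinuousLinearMap.id ℝ ℝ) := by
  refine ContinuousLinearMap.ext fun z => ?_
  simp

theorem frameMap_comp_isInvertible_iff {A : V →L[ℝ] W} {n : W} (C : V ≃L[ℝ] V) :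
    (frameMap (A ∘L (C : V →L[ℝ] V)) n).IsInvertible ↔ (frameMap A n).IsInvertible := by
  have : frameMap (A ∘L (C : V →L[ℝ] V)) n =
      frameMap A n ∘L (C.prodCongr (ContinuousLinearEquiv.refl ℝ ℝ) : V × ℝ →L[ℝ] V × ℝ) :=
    frameMap_comp A C n
  rw [this, ContinuousLinearMap.isInvertible_comp_equiv]

/-- A change of coordinates acts on `A` and `B` by the same right factor and cancels. -/
theorem shapeMap_comp {A B : V →L[ℝ] W} {n : W} (C : V ≃L[ℝ] V)
    (h : (frameMap A n).IsInvertible) :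
    shapeMap (A ∘L (C : V →L[ℝ] V)) (B ∘L (C : V →L[ℝ] V)) n = shapeMap A B n := by
  have h' := (frameMap_comp_isInvertible_iff C).2 h
  refine ContinuousLinearMap.ext fun w => ?_
  obtain ⟨v, s, rfl⟩ := exists_eq_frame h' w
  rw [shapeMap_apply h']
  exact (shapeMap_apply h (C v) s).symm

theorem ContinuousOn.shapeMap [CompleteSpace V] {X : Type*} [TopologicalSpace X] {s : Set X}
    {A B : X → V →L[ℝ] W} {n : X → W} (hA : ContinuousOn A s) (hB : ContinuousOn B s)
    (hn : ContinuousOn n s) (h : ∀ x ∈ s, (frameMap (A x) (n x)).IsInvertible) :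
    ContinuousOn (fun x => _root_.shapeMap (A x) (B x) (n x)) s := by
  intro x hx
  have hF : ContinuousWithinAt (fun x => frameMap (A x) (n x)) s x := by
    have h1 : ∀ x, frameMap (A x) (n x) = A x ∘L ContinuousLinearMap.fst ℝ V ℝ +
        (ContinuousLinearMap.snd ℝ V ℝ).smulRight (n x) := by
      intro x
      refine ContinuousLinearMap.ext fun z => ?_
      simp
    simp only [h1]
    refine ContinuousWithinAt.add ((hA x hx).clm_comp continuousWithinAt_const) ?_
    exact ((ContinuousLinearMap.smulRightL ℝ (V × ℝ) W
      (ContinuousLinearMap.snd ℝ V ℝ)).continuous.continuousAt).comp_continuousWithinAt (hn x hx)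
  refine ContinuousWithinAt.clm_comp ((hB x hx).clm_comp continuousWithinAt_const) ?_
  obtain ⟨e, he⟩ := h x hx
  have hi := (contDiffAt_map_inverse (𝕜 := ℝ) (n := 0) e).continuousAt
  rw [he] at hi
  exact ContinuousAt.comp_continuousWithinAt (f := fun x => frameMap (A x) (n x)) hi hF

end Frame

/-! ### The shape operator and the density of the layer -/

namespace OrientedHypersurface

variable {m : ℕ} {S : Type*} [TopologicalSpace S]
  [ChartedSpace (EuclideanSpace ℝ (Fin (m - 1))) S] (H : OrientedHypersurface m S)

/-- The immersion in the chart at `x`. -/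
def localP (x : S) : EuclideanSpace ℝ (Fin (m - 1)) → EuclideanSpace ℝ (Fin m) :=
  H.p ∘ (chartAt (EuclideanSpace ℝ (Fin (m - 1))) x).symm

/-- The unit normal field in the chart at `x`. -/
def localν (x : S) : EuclideanSpace ℝ (Fin (m - 1)) → EuclideanSpace ℝ (Fin m) :=
  H.ν ∘ (chartAt (EuclideanSpace ℝ (Fin (m - 1))) x).symm

/-- The linear map `(v, s) ↦ dp v + s ν`. -/
def frame (x : S) : EuclideanSpace ℝ (Fin (m - 1)) × ℝ →L[ℝ] EuclideanSpace ℝ (Fin m) :=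
  frameMap (V := EuclideanSpace ℝ (Fin (m - 1))) (H.dp x) (H.ν x)

/-- The endomorphism of `ℝ^m` which maps `dp v + s ν` to `dν v`: minus the Weingarten map,
extended by zero on the normal line. -/
def shape (x : S) : EuclideanSpace ℝ (Fin m) →L[ℝ] EuclideanSpace ℝ (Fin m) :=
  shapeMap (V := EuclideanSpace ℝ (Fin (m - 1))) (H.dp x) (H.dν x) (H.ν x)

/-- The density of the volume of the layer with respect to the product volume. -/
def density (x : S) (u : ℝ) : ℝ := |(1 + u • H.shape x).det|

theorem density_nonneg (x : S) (u : ℝ) : 0 ≤ H.density x u := abs_nonneg _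

theorem pos_dim [Nonempty S] (H : OrientedHypersurface m S) : 0 < m := by
  obtain ⟨x⟩ := ‹Nonempty S›
  rcases Nat.eq_zero_or_pos m with rfl | h
  · have h1 := H.norm_ν x
    rw [Subsingleton.elim (H.ν x) 0, norm_zero] at h1
    exact absurd h1 zero_ne_one
  · exact h

theorem frame_isInvertible (x : S) : (H.frame x).IsInvertible := by
  have : Nonempty S := ⟨x⟩
  refine frameMap_isInvertible ?_ (H.injective_mfderiv x) (H.norm_ν x) (H.normal x)
  have := H.pos_dim
  rw [finrank_euclideanSpace_fin, finrank_euclideanSpace_fin]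
  omega

theorem shape_apply (x : S) (v : TangentSpace (𝓡 (m - 1)) x) (s : ℝ) :
    H.shape x (H.dp x v + s • H.ν x) = H.dν x v :=
  shapeMap_apply (H.frame_isInvertible x) v s

theorem exists_eq_dp_add_smul (x : S) (w : EuclideanSpace ℝ (Fin m)) :
    ∃ (v : TangentSpace (𝓡 (m - 1)) x) (s : ℝ), w = H.dp x v + s • H.ν x :=
  exists_eq_frame (H.frame_isInvertible x) w

variable [IsManifold (𝓡 (m - 1)) 2 S]

theorem contDiffOn_localP (x : S) :
    ContDiffOn ℝ 2 (H.localP x) (chartAt (EuclideanSpace ℝ (Fin (m - 1))) x).target := by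
  rw [← contMDiffOn_iff_contDiffOn]
  exact H.contMDiff_p.comp_contMDiffOn contMDiffOn_chart_symm

theorem contDiffOn_localν (x : S) :
    ContDiffOn ℝ 1 (H.localν x) (chartAt (EuclideanSpace ℝ (Fin (m - 1))) x).target := by
  rw [← contMDiffOn_iff_contDiffOn]
  exact H.contMDiff_ν.comp_contMDiffOn ((contMDiffOn_chart_symm (n := 2)).of_le one_le_two)

/-- `C` is the differential at `y` of the chart at `x`. Intrinsic differentials at `y` refer to the
preferred chart at `y`, and computations over an open set need one fixed chart; since `C` is common
to `p` and `ν`, the shape operator does not see the difference. -/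
theorem exists_chart_deriv (x : S) {y : S}
    (hy : y ∈ (chartAt (EuclideanSpace ℝ (Fin (m - 1))) x).source) :
    ∃ C : EuclideanSpace ℝ (Fin (m - 1)) ≃L[ℝ] EuclideanSpace ℝ (Fin (m - 1)),
      H.dp y = fderiv ℝ (H.localP x) (chartAt (EuclideanSpace ℝ (Fin (m - 1))) x y) ∘L
        (C : EuclideanSpace ℝ (Fin (m - 1)) →L[ℝ] EuclideanSpace ℝ (Fin (m - 1))) ∧
      H.dν y = fderiv ℝ (H.localν x) (chartAt (EuclideanSpace ℝ (Fin (m - 1))) x y) ∘L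
        (C : EuclideanSpace ℝ (Fin (m - 1)) →L[ℝ] EuclideanSpace ℝ (Fin (m - 1))) := by
  set φ := chartAt (EuclideanSpace ℝ (Fin (m - 1))) x with hφ
  have hφd : φ.MDifferentiable (𝓡 (m - 1)) (𝓡 (m - 1)) := mdifferentiable_chart x
  have hmem : φ.target ∈ 𝓝 (φ y) := φ.open_target.mem_nhds (φ.map_source hy)
  have key : ∀ f : S → EuclideanSpace ℝ (Fin m),
      DifferentiableAt ℝ (f ∘ φ.symm) (φ y) →
      mfderiv (𝓡 (m - 1)) 𝓘(ℝ, EuclideanSpace ℝ (Fin m)) f y =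
        fderiv ℝ (f ∘ φ.symm) (φ y) ∘L mfderiv (𝓡 (m - 1)) (𝓡 (m - 1)) φ y := by
    intro f hf
    have h1 : f =ᶠ[𝓝 y] (f ∘ φ.symm) ∘ φ := by
      filter_upwards [φ.open_source.mem_nhds hy] with z hz
      simp [φ.left_inv hz]
    rw [h1.mfderiv_eq, mfderiv_comp (I' := 𝓡 (m - 1)) y hf.mdifferentiableAt
      (hφd.mdifferentiableAt hy), mfderiv_eq_fderiv]
    rfl
  refine ⟨hφd.mfderiv hy, ?_, ?_⟩
  · exact key H.p (((H.contDiffOn_localP x).contDiffAt hmem).differentiableAt (by norm_num))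
  · exact key H.ν (((H.contDiffOn_localν x).contDiffAt hmem).differentiableAt (by norm_num))

theorem local_frame_isInvertible (x : S) {w : EuclideanSpace ℝ (Fin (m - 1))}
    (hw : w ∈ (chartAt (EuclideanSpace ℝ (Fin (m - 1))) x).target) :
    (frameMap (fderiv ℝ (H.localP x) w) (H.localν x w)).IsInvertible := by
  set φ := chartAt (EuclideanSpace ℝ (Fin (m - 1))) x with hφ
  obtain ⟨C, hC, -⟩ := H.exists_chart_deriv x (φ.map_target hw)
  rw [← hφ, φ.right_inv hw] at hC
  rw [← frameMap_comp_isInvertible_iff C, ← hC]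
  exact H.frame_isInvertible (φ.symm w)

theorem shape_chart (x : S) {w : EuclideanSpace ℝ (Fin (m - 1))}
    (hw : w ∈ (chartAt (EuclideanSpace ℝ (Fin (m - 1))) x).target) :
    H.shape ((chartAt (EuclideanSpace ℝ (Fin (m - 1))) x).symm w) =
      shapeMap (fderiv ℝ (H.localP x) w) (fderiv ℝ (H.localν x) w) (H.localν x w) := by
  set φ := chartAt (EuclideanSpace ℝ (Fin (m - 1))) x with hφ
  obtain ⟨C, hC, hC'⟩ := H.exists_chart_deriv x (φ.map_target hw)
  rw [← hφ, φ.right_inv hw] at hC hC'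
  rw [← shapeMap_comp C (H.local_frame_isInvertible x hw), ← hC, ← hC']
  rfl

theorem continuous_shape : Continuous H.shape := by
  rw [continuous_iff_continuousAt]
  intro x
  set φ := chartAt (EuclideanSpace ℝ (Fin (m - 1))) x with hφ
  have hx : x ∈ φ.source := mem_chart_source _ x
  have h1 : ContinuousOn (fun w => shapeMap (fderiv ℝ (H.localP x) w) (fderiv ℝ (H.localν x) w)
      (H.localν x w)) φ.target :=
    ContinuousOn.shapeMap
      ((H.contDiffOn_localP x).continuousOn_fderiv_of_isOpen φ.open_target one_le_two)
      ((H.contDiffOn_localν x).continuousOn_fderiv_of_isOpen φ.open_target le_rfl)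
      (H.contDiffOn_localν x).continuousOn (fun w hw => H.local_frame_isInvertible x hw)
  have h2 : ContinuousOn (H.shape ∘ φ.symm) φ.target :=
    h1.congr fun w hw => H.shape_chart x hw
  have h3 := (h2.continuousAt (φ.open_target.mem_nhds (φ.map_source hx))).comp
    (φ.continuousAt hx)
  refine h3.congr ?_
  filter_upwards [φ.open_source.mem_nhds hx] with z hz
  simp [φ.left_inv hz]

theorem continuous_density : Continuous fun z : S × ℝ => H.density z.1 z.2 := by
  have h : Continuous fun z : S × ℝ => 1 + z.2 • H.shape z.1 :=
    continuous_const.add (continuous_snd.smul (H.continuous_shape.comp continuous_fst))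
  exact (ContinuousLinearMap.continuous_det.comp h).abs

/-- Differentiate `‖ν‖² = 1`. -/
theorem inner_dν_ν (x : S) (v : TangentSpace (𝓡 (m - 1)) x) :
    inner ℝ (H.ν x) (H.dν x v) = 0 := by
  set φ := chartAt (EuclideanSpace ℝ (Fin (m - 1))) x with hφ
  have hx : x ∈ φ.source := mem_chart_source _ x
  obtain ⟨C, -, hC⟩ := H.exists_chart_deriv x hx
  rw [← hφ] at hC
  have hd : HasFDerivAt (H.localν x) (fderiv ℝ (H.localν x) (φ x)) (φ x) :=
    (((H.contDiffOn_localν x).contDiffAt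
      (φ.open_target.mem_nhds (φ.map_source hx))).differentiableAt (by norm_num)).hasFDerivAt
  have h1 : HasFDerivAt (fun w => ‖H.localν x w‖ ^ 2) _ (φ x) := hd.norm_sq
  have h2 : (fun w => ‖H.localν x w‖ ^ 2) = fun _ => (1 : ℝ) := by
    ext w
    simp [localν, H.norm_ν]
  rw [h2] at h1
  have h3 := DFunLike.congr_fun (h1.unique (hasFDerivAt_const (1 : ℝ) (φ x))) (C v)
  have h4 : H.localν x (φ x) = H.ν x := by simp [localν, ← hφ, φ.left_inv hx]
  rw [h4] at h3
  have h5 : H.dν x v = fderiv ℝ (H.localν x) (φ x) (C v) := DFunLike.congr_fun hC v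
  rw [h5]
  simpa using h3

/-- The image of the shape operator is tangent, so a kernel vector has no normal part. A nonzero
tangent one would make `1 / u` a principal curvature, although `|1 / u| ≥ 1 / a` exceeds all of
them. -/
theorem one_add_smul_shape_injective {a : ℝ} (hA : H.BoundedWidth a) (x : S) {u : ℝ}
    (hu : |u| ≤ a) : Function.Injective
      (1 + u • H.shape x : EuclideanSpace ℝ (Fin m) →L[ℝ] EuclideanSpace ℝ (Fin m)) := by
  refine (injective_iff_map_eq_zero _).2 fun w hw => ?_
  obtain ⟨v, s, rfl⟩ := H.exists_eq_dp_add_smul x w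
  rw [add_apply, smul_apply, one_apply_eq_self] at hw
  have hw' : H.dp x v + s • H.ν x + u • H.dν x v = 0 := by
    rw [← hw]
    exact congrArg (fun t => H.dp x v + s • H.ν x + u • t) (H.shape_apply x v s).symm
  have hs : s = 0 := by
    have h := congrArg (inner ℝ (H.ν x)) hw'
    have h1 : inner ℝ (H.ν x) (H.dp x v) = 0 := H.normal x v
    rw [inner_add_right, inner_add_right, inner_smul_right, inner_smul_right, H.inner_dν_ν, h1,
      real_inner_self_eq_norm_sq, H.norm_ν] at h
    simpa using h
  subst hs
  rw [zero_smul, add_zero] at hw'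
  by_cases hv : v = 0
  · subst hv
    simp
  exfalso
  have hu0 : u ≠ 0 := by
    rintro rfl
    rw [zero_smul, add_zero] at hw'
    exact hv (H.injective_mfderiv x (hw'.trans (map_zero (H.dp x)).symm))
  obtain ⟨C, hC, hk⟩ := hA
  have h1 := hk x (1 / u) ⟨v, hv, by
    have : H.dp x v = - (u • H.dν x v) := eq_neg_of_add_eq_zero_left hw'
    rw [this, smul_neg, smul_smul, one_div_mul_cancel hu0, one_smul]⟩
  rw [abs_div, abs_one, div_le_iff₀ (abs_pos.2 hu0)] at h1
  have hC0 : 0 ≤ C := by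
    by_contra h
    have := abs_pos.2 hu0
    nlinarith
  nlinarith

theorem density_pos {a : ℝ} (hA : H.BoundedWidth a) (x : S) {u : ℝ} (hu : |u| ≤ a) :
    0 < H.density x u := by
  have h := H.one_add_smul_shape_injective hA x hu
  have h1 : IsUnit (1 + u • H.shape x : EuclideanSpace ℝ (Fin m) →L[ℝ] _).toLinearMap :=
    (LinearMap.isUnit_iff_ker_eq_bot _).2 (LinearMap.ker_eq_bot.2 h)
  exact abs_pos.2 (h1.map LinearMap.det).ne_zero

/-- Compactness of `K × [-a, a]`: since `a < ρ` is strict, the density is still positive at the end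
points `u = ± a`. -/
theorem exists_density_bounds {a : ℝ} (hA : H.BoundedWidth a) {K : Set S} (hK : IsCompact K) :
    ∃ c₁ c₂ : ℝ, 0 < c₁ ∧ 0 < c₂ ∧ ∀ x ∈ K, ∀ u, |u| ≤ a → c₁ ≤ H.density x u ∧
      H.density x u ≤ c₂ := by
  have hKc : IsCompact (K ×ˢ Icc (-a) a) := hK.prod isCompact_Icc
  rcases (K ×ˢ Icc (-a) a).eq_empty_or_nonempty with he | hne
  · refine ⟨1, 1, one_pos, one_pos, fun x hx u hu => ?_⟩
    have : (x, u) ∈ K ×ˢ Icc (-a) a := ⟨hx, abs_le.1 hu⟩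
    rw [he] at this
    exact this.elim
  obtain ⟨z, hz, hmin⟩ := hKc.exists_isMinOn hne H.continuous_density.continuousOn
  obtain ⟨z', hz', hmax⟩ := hKc.exists_isMaxOn hne H.continuous_density.continuousOn
  refine ⟨_, _, H.density_pos hA z.1 (abs_le.2 hz.2), H.density_pos hA z'.1 (abs_le.2 hz'.2),
    fun x hx u hu => ⟨?_, ?_⟩⟩
  · exact hmin (show (x, u) ∈ K ×ˢ Icc (-a) a from ⟨hx, abs_le.1 hu⟩)
  · exact hmax (show (x, u) ∈ K ×ˢ Icc (-a) a from ⟨hx, abs_le.1 hu⟩)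

/-- The normal line is in the kernel, and a tangent vector `dp v` has a tangent image `dν v`, whose
length is read off by pairing it with its own direction. -/
theorem norm_shape_le (x : S) : ‖H.shape x‖ ≤ H.normA x := by
  have hsh : ∀ v, H.shape x (H.dp x v) = H.dν x v := by
    intro v
    have := H.shape_apply x v 0
    rwa [zero_smul, add_zero] at this
  -- Without boundedness the real `sSup` in `normA` would be the default value `0`.
  have hbdd : BddAbove {r | ∃ v w : TangentSpace (𝓡 (m - 1)) x, ‖H.dp x v‖ ≤ 1 ∧ ‖H.dp x w‖ ≤ 1 ∧
      r = |H.secondFundamentalForm x v w|} := by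
    refine ⟨‖H.shape x‖, ?_⟩
    rintro r ⟨v, w, hv, hw, rfl⟩
    rw [secondFundamentalForm, abs_neg]
    refine (abs_real_inner_le_norm _ _).trans ?_
    rw [← hsh]
    calc ‖H.shape x (H.dp x v)‖ * ‖H.dp x w‖ ≤ (‖H.shape x‖ * 1) * 1 :=
          mul_le_mul ((H.shape x).le_opNorm_of_le hv) hw (norm_nonneg _) (by positivity)
      _ = ‖H.shape x‖ := by ring
  have hA0 : 0 ≤ H.normA x :=
    Real.sSup_nonneg (by rintro r ⟨v, w, -, -, rfl⟩; exact abs_nonneg _)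
  refine ContinuousLinearMap.opNorm_le_bound _ hA0 fun w => ?_
  obtain ⟨v, s, rfl⟩ := H.exists_eq_dp_add_smul x w
  obtain ⟨v', s', hv'⟩ := H.exists_eq_dp_add_smul x (H.dν x v)
  have hT : H.shape x (H.dp x v + s • H.ν x) = H.dν x v := H.shape_apply x v s
  have hν : ∀ v, inner ℝ (H.ν x) (H.dp x v) = 0 := H.normal x
  have hs' : s' = 0 := by
    have h : inner ℝ (H.ν x) (H.dν x v) = inner ℝ (H.ν x) (H.dp x v' + s' • H.ν x) :=
      congrArg _ hv'
    rw [H.inner_dν_ν, inner_add_right, inner_smul_right, hν, real_inner_self_eq_norm_sq,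
      H.norm_ν] at h
    simpa using h.symm
  have hv'' : H.dν x v = H.dp x v' := by
    refine hv'.trans ?_
    rw [hs', zero_smul, add_zero]
  have hle : ‖H.dp x v‖ ≤ ‖H.dp x v + s • H.ν x‖ := by
    have h1 : ‖H.dp x v + s • H.ν x‖ ^ 2 = ‖H.dp x v‖ ^ 2 + s ^ 2 := by
      rw [norm_add_sq_real, inner_smul_right, real_inner_comm, hν, norm_smul, H.norm_ν]
      simp
    refine le_of_sq_le_sq ?_ (norm_nonneg _)
    rw [h1]
    nlinarith [sq_nonneg s]
  refine (congrArg norm hT).le.trans (le_trans ?_ (mul_le_mul_of_nonneg_left hle hA0))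
  rcases eq_or_ne (H.dν x v) 0 with h0 | h0
  · rw [h0, norm_zero]
    exact mul_nonneg hA0 (norm_nonneg _)
  have hq : 0 < ‖H.dν x v‖ := norm_pos_iff.2 h0
  have hp : 0 < ‖H.dp x v‖ := by
    refine norm_pos_iff.2 fun h => h0 ?_
    rw [← hsh, h, map_zero]
  have h2 : |H.secondFundamentalForm x (‖H.dp x v‖⁻¹ • v) (‖H.dν x v‖⁻¹ • v')| ≤ H.normA x := by
    refine le_csSup hbdd ⟨_, _, ?_, ?_, rfl⟩
    · rw [map_smul, norm_smul, norm_inv, norm_norm, inv_mul_cancel₀ hp.ne']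
    · rw [map_smul, norm_smul, norm_inv, norm_norm, ← hv'', inv_mul_cancel₀ hq.ne']
  rw [secondFundamentalForm, map_smul, map_smul, inner_smul_left, inner_smul_right, ← hv'',
    real_inner_self_eq_norm_sq, abs_neg] at h2
  have h3 : (starRingEnd ℝ) ‖H.dp x v‖⁻¹ * (‖H.dν x v‖⁻¹ * ‖H.dν x v‖ ^ 2) =
      ‖H.dν x v‖ / ‖H.dp x v‖ := by
    rw [conj_trivial]
    field_simp
  rw [h3, abs_of_pos (by positivity), div_le_iff₀ hp] at h2
  exact h2

/-- Continuity of the determinant at the identity. The threshold `η` depends only on `a` and `ε`, so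
it serves all points at once. -/
theorem exists_density_near_one (a : ℝ) {ε : ℝ} (hε : 0 < ε) :
    ∃ η > 0, ∀ (H : OrientedHypersurface m S) (x : S), H.normA x < η → ∀ u, |u| ≤ a →
      |H.density x u - 1| ≤ ε := by
  have hc : ContinuousAt (fun A : EuclideanSpace ℝ (Fin m) →L[ℝ] EuclideanSpace ℝ (Fin m) =>
      |(1 + A).det|) 0 :=
    ((ContinuousLinearMap.continuous_det.comp (continuous_const.add continuous_id)).abs
      ).continuousAt
  obtain ⟨δ, hδ, h⟩ := Metric.continuousAt_iff.1 hc ε hε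
  refine ⟨δ / (|a| + 1), by positivity, fun H x hx u hu => ?_⟩
  have h1 : Dist.dist (u • H.shape x) 0 < δ := by
    rw [dist_zero_right, norm_smul, Real.norm_eq_abs]
    have h2 := H.norm_shape_le x
    rw [lt_div_iff₀ (by positivity)] at hx
    have h3 := le_abs_self a
    have h4 := norm_nonneg (H.shape x)
    calc |u| * ‖H.shape x‖ ≤ (|a| + 1) * H.normA x :=
          mul_le_mul (by linarith) h2 h4 (by positivity)
      _ < δ := by linarith
  have h2 := (h h1).le
  have h3 : (1 : EuclideanSpace ℝ (Fin m) →L[ℝ] EuclideanSpace ℝ (Fin m)).det = 1 :=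
    LinearMap.det_id
  rwa [Real.dist_eq, add_zero, h3, abs_one] at h2

end OrientedHypersurface

/-! ### Charts of the layer; the layer map is a local homeomorphism -/

namespace OrientedHypersurface

variable {m : ℕ} {S : Type*} [TopologicalSpace S]
  [ChartedSpace (EuclideanSpace ℝ (Fin (m - 1))) S] (H : OrientedHypersurface m S) {a : ℝ}

/-- The chart of the layer given by the chart of the hypersurface at `x`. -/
def layerChart (m : ℕ) {S : Type*} [TopologicalSpace S]
    [ChartedSpace (EuclideanSpace ℝ (Fin (m - 1))) S] {a : ℝ} (ha : 0 < a) (x : S) :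
    OpenPartialHomeomorph (Layer S a) (EuclideanSpace ℝ (Fin (m - 1)) × ℝ) :=
  haveI : Nonempty (Ioo (-a) a) := ⟨⟨0, by simpa using ha, ha⟩⟩
  (chartAt (EuclideanSpace ℝ (Fin (m - 1))) x).prod
    ((isOpen_Ioo.isOpenEmbedding_subtypeVal).toOpenPartialHomeomorph Subtype.val)

section layerChart

variable (ha : 0 < a) (x : S)

theorem layerChart_source : (layerChart m ha x).source =
    (chartAt (EuclideanSpace ℝ (Fin (m - 1))) x).source ×ˢ univ := by
  simp [layerChart]

theorem layerChart_target : (layerChart m ha x).target =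
    (chartAt (EuclideanSpace ℝ (Fin (m - 1))) x).target ×ˢ Ioo (-a) a := by
  simp [layerChart]
  rfl

theorem layerChart_apply (z : Layer S a) : layerChart m ha x z =
    (chartAt (EuclideanSpace ℝ (Fin (m - 1))) x z.1, (z.2 : ℝ)) := rfl

theorem layerChart_symm_apply {w : EuclideanSpace ℝ (Fin (m - 1))} {u : ℝ} (hu : u ∈ Ioo (-a) a) :
    (layerChart m ha x).symm (w, u) =
      ((chartAt (EuclideanSpace ℝ (Fin (m - 1))) x).symm w, ⟨u, hu⟩) := by
  have : Nonempty (Ioo (-a) a) := ⟨⟨u, hu⟩⟩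
  refine Prod.ext rfl ?_
  exact (isOpen_Ioo.isOpenEmbedding_subtypeVal).toOpenPartialHomeomorph_left_inv (x := ⟨u, hu⟩)

end layerChart

/-- The layer map in the chart at `x`. -/
def localΦ (x : S) (w : EuclideanSpace ℝ (Fin (m - 1)) × ℝ) : EuclideanSpace ℝ (Fin m) :=
  H.localP x w.1 + w.2 • H.localν x w.1

theorem Φ_eq_localΦ (ha : 0 < a) (x : S) {z : Layer S a} (hz : z ∈ (layerChart m ha x).source) :
    H.Φ z = H.localΦ x (layerChart m ha x z) := by
  rw [layerChart_source] at hz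
  simp [Φ, localΦ, layerChart_apply, localP, localν, OpenPartialHomeomorph.left_inv _ hz.1]

/-- The derivative of the layer map in the chart at `x`. -/
def localΦ' (x : S) (w : EuclideanSpace ℝ (Fin (m - 1)) × ℝ) :
    EuclideanSpace ℝ (Fin (m - 1)) × ℝ →L[ℝ] EuclideanSpace ℝ (Fin m) :=
  frameMap (fderiv ℝ (H.localP x) w.1 + w.2 • fderiv ℝ (H.localν x) w.1) (H.localν x w.1)

variable [IsManifold (𝓡 (m - 1)) 2 S]

theorem contDiffAt_localΦ (x : S) {w : EuclideanSpace ℝ (Fin (m - 1)) × ℝ}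
    (hw : w.1 ∈ (chartAt (EuclideanSpace ℝ (Fin (m - 1))) x).target) :
    ContDiffAt ℝ 1 (H.localΦ x) w := by
  have hn := (chartAt (EuclideanSpace ℝ (Fin (m - 1))) x).open_target.mem_nhds hw
  have h1 : ContDiffAt ℝ 1 (H.localP x) w.1 :=
    ((H.contDiffOn_localP x).contDiffAt hn).of_le one_le_two
  have h2 : ContDiffAt ℝ 1 (H.localν x) w.1 := (H.contDiffOn_localν x).contDiffAt hn
  exact (h1.comp w contDiffAt_fst).add (contDiffAt_snd.smul (h2.comp w contDiffAt_fst))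

theorem hasFDerivAt_localΦ (x : S) {w : EuclideanSpace ℝ (Fin (m - 1)) × ℝ}
    (hw : w.1 ∈ (chartAt (EuclideanSpace ℝ (Fin (m - 1))) x).target) :
    HasFDerivAt (H.localΦ x) (H.localΦ' x w) w := by
  have hn := (chartAt (EuclideanSpace ℝ (Fin (m - 1))) x).open_target.mem_nhds hw
  have h1 : HasFDerivAt (H.localP x) (fderiv ℝ (H.localP x) w.1) w.1 :=
    (((H.contDiffOn_localP x).contDiffAt hn).differentiableAt (by norm_num)).hasFDerivAt
  have h2 : HasFDerivAt (H.localν x) (fderiv ℝ (H.localν x) w.1) w.1 :=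
    (((H.contDiffOn_localν x).contDiffAt hn).differentiableAt (by norm_num)).hasFDerivAt
  have h3 := (h1.comp w hasFDerivAt_fst).add (hasFDerivAt_snd.smul (h2.comp w hasFDerivAt_fst))
  refine h3.congr_fderiv (ContinuousLinearMap.ext fun v => ?_)
  simp [localΦ']
  abel

theorem localΦ'_eq (x : S) {w : EuclideanSpace ℝ (Fin (m - 1)) × ℝ}
    (hw : w.1 ∈ (chartAt (EuclideanSpace ℝ (Fin (m - 1))) x).target) :
    H.localΦ' x w =
      (1 + w.2 • H.shape ((chartAt (EuclideanSpace ℝ (Fin (m - 1))) x).symm w.1)) ∘L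
        frameMap (fderiv ℝ (H.localP x) w.1) (H.localν x w.1) := by
  rw [localΦ', frameMap_add_smul (H.local_frame_isInvertible x hw), H.shape_chart x hw]

theorem localΦ'_isInvertible (hA : H.BoundedWidth a) (x : S)
    {w : EuclideanSpace ℝ (Fin (m - 1)) × ℝ}
    (hw : w.1 ∈ (chartAt (EuclideanSpace ℝ (Fin (m - 1))) x).target) (hu : |w.2| ≤ a) :
    (H.localΦ' x w).IsInvertible := by
  rw [H.localΦ'_eq x hw]
  have h := H.one_add_smul_shape_injective hA
    ((chartAt (EuclideanSpace ℝ (Fin (m - 1))) x).symm w.1) hu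
  refine ContinuousLinearMap.IsInvertible.comp ?_ (H.local_frame_isInvertible x hw)
  exact ⟨(LinearEquiv.ofInjectiveEndo _ h).toContinuousLinearEquiv, by ext v; rfl⟩

/-- The inverse function theorem in a chart, where `Φ` is `C¹` with invertible differential because
`a < ρ`. -/
theorem isLocalHomeomorph_Φ (ha : 0 < a) (hA : H.BoundedWidth a) :
    IsLocalHomeomorph (H.Φ : Layer S a → _) := by
  refine IsLocalHomeomorph.mk _ fun z => ?_
  set c := layerChart m ha z.1 with hc
  have hz : z ∈ c.source := by
    rw [hc, layerChart_source]
    exact ⟨mem_chart_source _ z.1, mem_univ _⟩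
  have hcz : c z ∈ c.target := c.map_source hz
  rw [hc, layerChart_target] at hcz
  obtain ⟨e, he⟩ := H.localΦ'_isInvertible hA z.1 hcz.1 (abs_lt.2 hcz.2).le
  have hd : HasFDerivAt (H.localΦ z.1) (e : _ →L[ℝ] _) (c z) := by
    rw [he]
    exact H.hasFDerivAt_localΦ z.1 hcz.1
  have hcd := H.contDiffAt_localΦ z.1 hcz.1
  refine ⟨c.trans (hcd.toOpenPartialHomeomorph (H.localΦ z.1) hd one_ne_zero), ?_, ?_⟩
  · rw [OpenPartialHomeomorph.trans_source]
    exact ⟨hz, hcd.mem_toOpenPartialHomeomorph_source hd one_ne_zero⟩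
  · intro y hy
    rw [OpenPartialHomeomorph.trans_source] at hy
    exact H.Φ_eq_localΦ ha z.1 hy.1

end OrientedHypersurface

/-! ### The volume measure of the layer -/

namespace OrientedHypersurface

variable {m : ℕ} {S : Type*} [TopologicalSpace S]
  [ChartedSpace (EuclideanSpace ℝ (Fin (m - 1))) S] (H : OrientedHypersurface m S) {a : ℝ}

theorem isOpenEmbedding_restrict_Φ (hloc : IsLocalHomeomorph (H.Φ : Layer S a → _))
    {U : Set (Layer S a)} (hU : IsOpen U) (hinj : InjOn H.Φ U) :
    IsOpenEmbedding (fun z : U => H.Φ (z : Layer S a)) :=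
  (hloc.comp hU.isOpenEmbedding_subtypeVal.isLocalHomeomorph).isOpenEmbedding_of_injective
    (injOn_iff_injective.1 hinj)

theorem exists_injOn_nhds (hloc : IsLocalHomeomorph (H.Φ : Layer S a → _)) {V : Set (Layer S a)}
    (hV : IsOpen V) {z : Layer S a} (hz : z ∈ V) :
    ∃ U ⊆ V, IsOpen U ∧ z ∈ U ∧ InjOn H.Φ U := by
  obtain ⟨e, he, h⟩ := hloc z
  refine ⟨V ∩ e.source, inter_subset_left, hV.inter e.open_source, ⟨hz, he⟩, ?_⟩
  rw [h]
  exact e.injOn.mono inter_subset_right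

variable [SecondCountableTopology S] [MeasurableSpace S] [BorelSpace S]

theorem map_comap_volume_apply (hloc : IsLocalHomeomorph (H.Φ : Layer S a → _))
    {U B : Set (Layer S a)} (hU : IsOpen U) (hinj : InjOn H.Φ U) (hB : MeasurableSet B) :
    ((volume : Measure (EuclideanSpace ℝ (Fin m))).comap
      (fun z : U => H.Φ (z : Layer S a))).map Subtype.val B = volume (H.Φ '' (B ∩ U)) := by
  rw [Measure.map_apply measurable_subtype_coe hB,
    (H.isOpenEmbedding_restrict_Φ hloc hU hinj).measurableEmbedding.comap_apply]
  congr 1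
  ext y
  simp only [mem_image, mem_preimage, Subtype.exists, mem_inter_iff]
  constructor
  · rintro ⟨z, hz, hzB, rfl⟩; exact ⟨z, ⟨hzB, hz⟩, rfl⟩
  · rintro ⟨z, ⟨hzB, hz⟩, rfl⟩; exact ⟨z, hz, hzB, rfl⟩

/-- A supremum of measures is not computed set by set, so one measure dominating all the competitors
is exhibited: inside `U` each of them is at most `μ U`, because both measure images under the same
map `Φ`; outside `U` each is at most the supremum. -/
theorem layerVolume_apply (hloc : IsLocalHomeomorph (H.Φ : Layer S a → _))
    {U B : Set (Layer S a)} (hU : IsOpen U) (hinj : InjOn H.Φ U) (hB : MeasurableSet B)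
    (hBU : B ⊆ U) : H.layerVolume B = volume (H.Φ '' B) := by
  set μ : Set (Layer S a) → Measure (Layer S a) := fun V =>
    ((volume : Measure (EuclideanSpace ℝ (Fin m))).comap
      (fun z : V => H.Φ (z : Layer S a))).map Subtype.val with hμ
  have hμa : ∀ {V B}, IsOpen V → InjOn H.Φ V → MeasurableSet B → μ V B = volume (H.Φ '' (B ∩ V)) :=
    fun hV hi hB => H.map_comap_volume_apply hloc hV hi hB
  have hVle : ∀ V, IsOpen V → InjOn H.Φ V → μ V ≤ H.layerVolume := fun V hV hi =>
    le_iSup₂ (f := fun V (_ : IsOpen V ∧ InjOn H.Φ V) => μ V) V ⟨hV, hi⟩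
  have hle : H.layerVolume ≤ μ U + H.layerVolume.restrict Uᶜ := by
    refine iSup₂_le fun V hV => Measure.le_iff.2 fun s hs => ?_
    change μ V s ≤ _
    rw [← measure_inter_add_sdiff s hU.measurableSet, Measure.add_apply]
    refine add_le_add ?_ ?_
    · rw [hμa hV.1 hV.2 (hs.inter hU.measurableSet), hμa hU hinj hs]
      exact measure_mono (image_mono inter_subset_left)
    · rw [Measure.restrict_apply hs, ← sdiff_eq]
      exact hVle V hV.1 hV.2 _
  refine le_antisymm ?_ ?_
  · refine (hle B).trans ?_
    rw [Measure.add_apply, Measure.restrict_apply hB, hμa hU hinj hB,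
      inter_eq_left.2 hBU, (disjoint_compl_right_iff_subset.2 hBU).inter_eq, measure_empty,
      add_zero]
  · refine le_trans (le_of_eq ?_) (hVle U hU hinj B)
    rw [hμa hU hinj hB, inter_eq_left.2 hBU]

theorem isLocallyFiniteMeasure_layerVolume (hloc : IsLocalHomeomorph (H.Φ : Layer S a → _)) :
    IsLocallyFiniteMeasure (H.layerVolume : Measure (Layer S a)) := by
  refine ⟨fun z => ?_⟩
  have hV : IsOpen (H.Φ ⁻¹' Metric.ball (H.Φ z) 1 : Set (Layer S a)) :=
    Metric.isOpen_ball.preimage hloc.continuous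
  obtain ⟨U, hUV, hU, hz, hinj⟩ := H.exists_injOn_nhds hloc hV (Metric.mem_ball_self one_pos)
  refine ⟨U, hU.mem_nhds hz, ?_⟩
  rw [H.layerVolume_apply hloc hU hinj hU.measurableSet le_rfl]
  exact (measure_mono (image_subset_iff.2 hUV)).trans_lt measure_ball_lt_top

theorem isOpenPosMeasure_layerVolume (hloc : IsLocalHomeomorph (H.Φ : Layer S a → _)) :
    (H.layerVolume : Measure (Layer S a)).IsOpenPosMeasure := by
  refine ⟨fun V hV hne h0 => ?_⟩
  obtain ⟨z, hz⟩ := hne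
  obtain ⟨U, hUV, hU, hz, hinj⟩ := H.exists_injOn_nhds hloc hV hz
  have h1 : volume (H.Φ '' U) = 0 := by
    rw [← H.layerVolume_apply hloc hU hinj hU.measurableSet le_rfl]
    exact measure_mono_null hUV h0
  exact (hloc.isOpenMap U hU).measure_pos volume ⟨_, mem_image_of_mem _ hz⟩ |>.ne' h1

end OrientedHypersurface

/-! ### Change of variables and Fubini in the charts of the layer -/

theorem OpenPartialHomeomorph.measurableSet_image {X Y : Type*} [TopologicalSpace X]
    [MeasurableSpace X] [BorelSpace X] [TopologicalSpace Y] [MeasurableSpace Y] [BorelSpace Y]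
    (e : OpenPartialHomeomorph X Y) {s : Set X} (hs : MeasurableSet s) (hse : s ⊆ e.source) :
    MeasurableSet (e '' s) := by
  have h := e.isOpenEmbedding_restrict.measurableEmbedding.measurableSet_image'
    (measurable_subtype_coe hs)
  convert h using 1
  ext y
  simp only [mem_image, mem_preimage, Subtype.exists]
  constructor
  · rintro ⟨x, hx, rfl⟩; exact ⟨x, hse hx, hx, rfl⟩
  · rintro ⟨x, -, hx, rfl⟩; exact ⟨x, hx, rfl⟩

namespace OrientedHypersurface

variable {m : ℕ} {S : Type*} [TopologicalSpace S]
  [ChartedSpace (EuclideanSpace ℝ (Fin (m - 1))) S] (H : OrientedHypersurface m S) {a : ℝ}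

/-- The Jacobian of the layer map in the chart at `x`, with respect to an identification `e`. -/
def localJac (e : EuclideanSpace ℝ (Fin m) ≃L[ℝ] EuclideanSpace ℝ (Fin (m - 1)) × ℝ) (x : S)
    (w : EuclideanSpace ℝ (Fin (m - 1)) × ℝ) : ℝ≥0∞ :=
  ENNReal.ofReal |(e.toContinuousLinearMap ∘L H.localΦ' x w).det|

variable [IsManifold (𝓡 (m - 1)) 2 S]

theorem continuousOn_localJac
    (e : EuclideanSpace ℝ (Fin m) ≃L[ℝ] EuclideanSpace ℝ (Fin (m - 1)) × ℝ) (x : S) :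
    ContinuousOn (H.localJac e x)
      ((chartAt (EuclideanSpace ℝ (Fin (m - 1))) x).target ×ˢ univ) := by
  set φ := chartAt (EuclideanSpace ℝ (Fin (m - 1))) x with hφ
  have hfst : MapsTo Prod.fst (φ.target ×ˢ (univ : Set ℝ)) φ.target := fun w hw => hw.1
  have hP := ((H.contDiffOn_localP x).continuousOn_fderiv_of_isOpen φ.open_target
    one_le_two).comp continuousOn_fst hfst
  have hN := ((H.contDiffOn_localν x).continuousOn_fderiv_of_isOpen φ.open_target
    le_rfl).comp continuousOn_fst hfst
  have hN0 := (H.contDiffOn_localν x).continuousOn.comp continuousOn_fst hfst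
  have h1 : ∀ w, H.localΦ' x w = (fderiv ℝ (H.localP x) w.1 + w.2 • fderiv ℝ (H.localν x) w.1) ∘L
      ContinuousLinearMap.fst ℝ _ ℝ + ContinuousLinearMap.smulRightL ℝ _ _
        (ContinuousLinearMap.snd ℝ (EuclideanSpace ℝ (Fin (m - 1))) ℝ) (H.localν x w.1) := by
    intro w
    refine ContinuousLinearMap.ext fun v => ?_
    simp [localΦ']
  have h2 : ContinuousOn (H.localΦ' x) (φ.target ×ˢ univ) := by
    rw [funext h1]
    refine ContinuousOn.add ((hP.add (continuousOn_snd.smul hN)).clm_comp continuousOn_const) ?_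
    exact (ContinuousLinearMap.continuous _).comp_continuousOn hN0
  exact ENNReal.continuous_ofReal.comp_continuousOn
    (ContinuousLinearMap.continuous_det.comp_continuousOn (continuousOn_const.clm_comp h2)).abs

/-- Conjugation by `e` does not change the determinant of `D`. Hence the Jacobian splits into a
factor depending on the base point only and the density. -/
theorem localJac_eq (e : EuclideanSpace ℝ (Fin m) ≃L[ℝ] EuclideanSpace ℝ (Fin (m - 1)) × ℝ)
    (x : S) {y : EuclideanSpace ℝ (Fin (m - 1))} (u : ℝ)
    (hy : y ∈ (chartAt (EuclideanSpace ℝ (Fin (m - 1))) x).target) :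
    H.localJac e x (y, u) = H.localJac e x (y, 0) *
      ENNReal.ofReal (H.density ((chartAt (EuclideanSpace ℝ (Fin (m - 1))) x).symm y) u) := by
  set D := 1 + u • H.shape ((chartAt (EuclideanSpace ℝ (Fin (m - 1))) x).symm y) with hD
  have h0 : H.localΦ' x (y, 0) = frameMap (fderiv ℝ (H.localP x) y) (H.localν x y) := by
    have hz : (0 : ℝ) • fderiv ℝ (H.localν x) y = 0 :=
      ContinuousLinearMap.ext fun v => zero_smul ℝ (fderiv ℝ (H.localν x) y v)
    rw [localΦ', hz, add_zero]
  have h1 : H.localΦ' x (y, u) = D ∘L H.localΦ' x (y, 0) := by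
    rw [h0, H.localΦ'_eq x hy]
  have h2 : (e.toContinuousLinearMap ∘L H.localΦ' x (y, u)).det =
      (e.toContinuousLinearMap ∘L H.localΦ' x (y, 0)).det * D.det := by
    have h3 : (e.toContinuousLinearMap ∘L H.localΦ' x (y, u) :
        EuclideanSpace ℝ (Fin (m - 1)) × ℝ →ₗ[ℝ] EuclideanSpace ℝ (Fin (m - 1)) × ℝ) =
        ((e.toLinearEquiv : EuclideanSpace ℝ (Fin m) →ₗ[ℝ] _) ∘ₗ D.toLinearMap ∘ₗ
          (e.toLinearEquiv.symm : _ →ₗ[ℝ] EuclideanSpace ℝ (Fin m))) ∘ₗ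
          (e.toContinuousLinearMap ∘L H.localΦ' x (y, 0)).toLinearMap := by
      rw [h1]
      refine LinearMap.ext fun v => ?_
      simp
    unfold ContinuousLinearMap.det
    rw [h3, LinearMap.det_comp, LinearMap.det_conj, mul_comm]
  rw [localJac, localJac, h2, abs_mul, ENNReal.ofReal_mul (abs_nonneg _)]
  rfl

variable [SecondCountableTopology S] [MeasurableSpace S] [BorelSpace S]

theorem layerVolume_eq_lintegral_localJac (ha : 0 < a) (hA : H.BoundedWidth a)
    (e : EuclideanSpace ℝ (Fin m) ≃L[ℝ] EuclideanSpace ℝ (Fin (m - 1)) × ℝ) (x : S)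
    {U B : Set (Layer S a)} (hU : IsOpen U) (hUs : U ⊆ (layerChart m ha x).source)
    (hinj : InjOn H.Φ U) (hB : MeasurableSet B) (hBU : B ⊆ U) :
    H.layerVolume B = ∫⁻ w in layerChart m ha x '' B, H.localJac e x w ∂(volume.map e) := by
  have hloc := H.isLocalHomeomorph_Φ ha hA
  set c := layerChart m ha x with hc
  have hΦ : ∀ z ∈ B, H.Φ z = H.localΦ x (c z) := fun z hz =>
    H.Φ_eq_localΦ ha x (hUs (hBU hz))
  have hmem : ∀ w ∈ c '' B, w.1 ∈ (chartAt (EuclideanSpace ℝ (Fin (m - 1))) x).target := by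
    rintro _ ⟨z, hz, rfl⟩
    have := c.map_source (hUs (hBU hz))
    rw [hc, layerChart_target] at this
    exact this.1
  have hinj' : InjOn (e ∘ H.localΦ x) (c '' B) := by
    rintro _ ⟨z, hz, rfl⟩ _ ⟨z', hz', rfl⟩ h
    have h' := e.injective h
    rw [← hΦ z hz, ← hΦ z' hz'] at h'
    rw [hinj (hBU hz) (hBU hz') h']
  have hmeas : MeasurableSet (c '' B) := c.measurableSet_image hB (hBU.trans hUs)
  have h := lintegral_abs_det_fderiv_eq_addHaar_image (volume.map e) hmeas
    (fun w hw => (e.toContinuousLinearMap.hasFDerivAt.comp w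
      (H.hasFDerivAt_localΦ x (hmem w hw))).hasFDerivWithinAt) hinj'
  rw [H.layerVolume_apply hloc hU hinj hB hBU]
  refine Eq.trans ?_ h.symm
  refine Eq.trans ?_ (e.toHomeomorph.measurableEmbedding.map_apply _ _).symm
  congr 1
  ext y
  simp only [mem_image, mem_preimage, exists_exists_and_eq_and, Function.comp_apply]
  constructor
  · rintro ⟨z, hz, rfl⟩
    exact ⟨z, hz, by rw [hΦ z hz]; rfl⟩
  · rintro ⟨z, hz, hzy⟩
    exact ⟨z, hz, by rw [hΦ z hz]; exact e.injective hzy⟩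

theorem setLIntegral_layerVolume (ha : 0 < a) (hA : H.BoundedWidth a)
    (e : EuclideanSpace ℝ (Fin m) ≃L[ℝ] EuclideanSpace ℝ (Fin (m - 1)) × ℝ) (x : S)
    {F : Layer S a → ℝ≥0∞} (hF : Measurable F) :
    ∫⁻ z in (layerChart m ha x).source, F z ∂H.layerVolume =
      ∫⁻ w in (layerChart m ha x).target, H.localJac e x w * F ((layerChart m ha x).symm w)
        ∂(volume.map e) := by
  have hloc := H.isLocalHomeomorph_Φ ha hA
  set c := layerChart m ha x with hc
  set μ : Measure (EuclideanSpace ℝ (Fin (m - 1)) × ℝ) := volume.map e with hμ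
  have hJ : AEMeasurable (H.localJac e x) (μ.restrict c.target) := by
    refine ContinuousOn.aemeasurable ((H.continuousOn_localJac e x).mono ?_)
      c.open_target.measurableSet
    rw [hc, layerChart_target]
    exact prod_mono le_rfl (subset_univ _)
  have hcs : AEMeasurable c.symm (μ.restrict c.target) :=
    c.continuousOn_symm.aemeasurable c.open_target.measurableSet
  set ρ := ((μ.restrict c.target).withDensity (H.localJac e x)).map c.symm with hρ
  have hcs' : AEMeasurable c.symm ((μ.restrict c.target).withDensity (H.localJac e x)) :=
    hcs.mono_ac (withDensity_absolutelyContinuous _ _)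
  have hρB : ∀ B, MeasurableSet B → B ⊆ c.source → ρ B = ∫⁻ w in c '' B, H.localJac e x w ∂μ := by
    intro B hB hBs
    rw [hρ, Measure.map_apply_of_aemeasurable hcs' hB, withDensity_apply',
      Measure.restrict_restrict' c.open_target.measurableSet, inter_comm,
      ← c.image_eq_target_inter_inv_preimage hBs]
  have hρc : ρ c.sourceᶜ = 0 := by
    rw [hρ, Measure.map_apply_of_aemeasurable hcs' c.open_source.measurableSet.compl,
      withDensity_apply', Measure.restrict_restrict' c.open_target.measurableSet]
    have : c.symm ⁻¹' c.sourceᶜ ∩ c.target = ∅ := by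
      rw [eq_empty_iff_forall_notMem]
      rintro w ⟨hw, hw'⟩
      exact hw (c.map_target hw')
    rw [this]
    simp
  have hρr : ρ.restrict c.source = ρ := Measure.restrict_eq_self_of_ae_mem hρc
  -- `Φ` need not be injective on the chart domain. Second countability covers this domain by
  -- countably many open sets of injectivity, and two measures that agree on each of them agree on
  -- the union.
  choose! U hUs hU hzU hinj using fun z (hz : z ∈ c.source) =>
    H.exists_injOn_nhds hloc c.open_source hz
  obtain ⟨T, hTs, hT, hTc⟩ := TopologicalSpace.countable_cover_nhdsWithin
    (fun z (hz : z ∈ c.source) => mem_nhdsWithin_of_mem_nhds ((hU z hz).mem_nhds (hzU z hz)))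
  have hcover : c.source = ⋃ z ∈ T, U z :=
    hTc.antisymm (iUnion₂_subset fun z hz => hUs z (hTs hz))
  have hres : H.layerVolume.restrict c.source = ρ := by
    rw [← hρr, hcover, Measure.restrict_biUnion_congr hT]
    intro z hz
    have hz' := hTs hz
    refine Measure.ext fun B hB => ?_
    rw [Measure.restrict_apply hB, Measure.restrict_apply hB,
      H.layerVolume_eq_lintegral_localJac ha hA e x (hU z hz') (hUs z hz') (hinj z hz')
        (hB.inter (hU z hz').measurableSet) inter_subset_right,
      hρB _ (hB.inter (hU z hz').measurableSet) (inter_subset_right.trans (hUs z hz'))]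
  rw [hres, hρ, lintegral_map' hF.aemeasurable hcs']
  exact lintegral_withDensity_eq_lintegral_mul₀ hJ (hF.comp_aemeasurable hcs)

end OrientedHypersurface

namespace OrientedHypersurface

variable {m : ℕ} {S : Type*} [TopologicalSpace S]
  [ChartedSpace (EuclideanSpace ℝ (Fin (m - 1))) S] (H : OrientedHypersurface m S) {a : ℝ}
  [IsManifold (𝓡 (m - 1)) 2 S] [SecondCountableTopology S] [MeasurableSpace S] [BorelSpace S]

/-- **Fubini** for the layer, in the domain of a chart of the hypersurface. -/
theorem exists_setLIntegral_layerVolume (ha : 0 < a) (hA : H.BoundedWidth a) (x : S) :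
    ∃ J : EuclideanSpace ℝ (Fin (m - 1)) → ℝ≥0∞, ∀ F : Layer S a → ℝ≥0∞, Measurable F →
      ∫⁻ z in (chartAt (EuclideanSpace ℝ (Fin (m - 1))) x).source ×ˢ univ, F z ∂H.layerVolume =
        ∫⁻ w in (chartAt (EuclideanSpace ℝ (Fin (m - 1))) x).target, J w *
          ∫⁻ u : Ioo (-a) a,
            ENNReal.ofReal (H.density ((chartAt (EuclideanSpace ℝ (Fin (m - 1))) x).symm w) u) *
            F ((chartAt (EuclideanSpace ℝ (Fin (m - 1))) x).symm w, u)
          ∂((volume : Measure ℝ).comap Subtype.val) := by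
  obtain ⟨e', -⟩ := H.frame_isInvertible x
  set e := e'.symm
  set φ := chartAt (EuclideanSpace ℝ (Fin (m - 1))) x with hφ
  set c := layerChart m ha x with hc
  set μ : Measure (EuclideanSpace ℝ (Fin (m - 1)) × ℝ) := volume.map e with hμ
  set vol : Measure (EuclideanSpace ℝ (Fin (m - 1)) × ℝ) := volume.prod volume with hvol
  -- Both are translation invariant, so they are proportional. The constant is the same on all
  -- fibres and need not be known.
  obtain ⟨k, hk⟩ : ∃ k : ℝ≥0∞, μ = k • vol := ⟨_, Measure.isAddLeftInvariant_eq_smul μ vol⟩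
  refine ⟨fun w => k * H.localJac e x (w, 0), fun F hF => ?_⟩
  have hsrc : φ.source ×ˢ univ = c.source := by rw [hc, layerChart_source]
  have htgt : c.target = φ.target ×ˢ Ioo (-a) a := by rw [hc, layerChart_target]
  have hcs : AEMeasurable c.symm (vol.restrict c.target) :=
    c.continuousOn_symm.aemeasurable c.open_target.measurableSet
  have hJ : AEMeasurable (H.localJac e x) (vol.restrict c.target) := by
    refine ContinuousOn.aemeasurable ((H.continuousOn_localJac e x).mono ?_)
      c.open_target.measurableSet
    rw [htgt]
    exact prod_mono le_rfl (subset_univ _)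
  have hm := hJ.mul (hF.comp_aemeasurable hcs)
  rw [htgt, hvol, ← Measure.prod_restrict] at hm
  have h1 : ∫⁻ z in c.source, F z ∂H.layerVolume =
      k * ∫⁻ w, (H.localJac e x * F ∘ c.symm) w
        ∂(volume.restrict φ.target).prod (volume.restrict (Ioo (-a) a)) := by
    rw [H.setLIntegral_layerVolume ha hA e x hF, ← hμ, hk, Measure.restrict_smul,
      lintegral_smul_measure, ← hc, htgt, hvol, ← Measure.prod_restrict]
    rfl
  rw [hsrc, h1, lintegral_prod _ hm, ← lintegral_const_mul'' _ hm.lintegral_prod_right']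
  refine setLIntegral_congr_fun φ.open_target.measurableSet fun w hw => ?_
  rw [mul_assoc]
  congr 1
  rw [← lintegral_subtype_comap measurableSet_Ioo]
  have : ∀ u : Ioo (-a) a, H.localJac e x (w, u) * F (c.symm (w, u)) = H.localJac e x (w, 0) *
      (ENNReal.ofReal (H.density (φ.symm w) u) * F (φ.symm w, u)) := by
    intro u
    rw [H.localJac_eq e x u hw, hc, layerChart_symm_apply ha x u.2, mul_assoc]
  simp only [Pi.mul_apply, Function.comp_apply, this]
  exact lintegral_const_mul' _ _ ENNReal.ofReal_ne_top

/-- Comparison of two integrals over the layer from the comparison on the fibres. -/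
theorem lintegral_layerVolume_mono (ha : 0 < a) (hA : H.BoundedWidth a) {F G : Layer S a → ℝ≥0∞}
    (hF : Measurable F) (hG : Measurable G)
    (hFG : ∀ x : S, ∫⁻ u : Ioo (-a) a, ENNReal.ofReal (H.density x u) * F (x, u)
        ∂((volume : Measure ℝ).comap Subtype.val) ≤
      ∫⁻ u : Ioo (-a) a, ENNReal.ofReal (H.density x u) * G (x, u)
        ∂((volume : Measure ℝ).comap Subtype.val)) :
    ∫⁻ z, F z ∂H.layerVolume ≤ ∫⁻ z, G z ∂H.layerVolume := by
  rcases isEmpty_or_nonempty S with hS | hS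
  · simp [Measure.eq_zero_of_isEmpty]
  set V : S → Set S := fun x => (chartAt (EuclideanSpace ℝ (Fin (m - 1))) x).source with hV
  obtain ⟨T, hT, hTc⟩ := TopologicalSpace.countable_cover_nhds
    (fun x : S => chart_source_mem_nhds (EuclideanSpace ℝ (Fin (m - 1))) x)
  have hTne : T.Nonempty := by
    rw [nonempty_iff_ne_empty]
    rintro rfl
    rw [biUnion_empty] at hTc
    exact empty_ne_univ hTc
  obtain ⟨f, rfl⟩ := hT.exists_eq_range hTne
  -- The layer is cut over disjoint pieces of the base, which keeps every fibre whole; the indicator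
  -- of a piece is constant on fibres and respects the fibrewise inequality.
  set D : ℕ → Set S := disjointed fun n => V (f n) with hD
  have hDm : ∀ n, MeasurableSet (D n) := fun n =>
    MeasurableSet.disjointed (fun n => (OpenPartialHomeomorph.open_source _).measurableSet) n
  have hDs : ∀ n, D n ⊆ V (f n) := fun n => disjointed_subset _ n
  have hcov : (⋃ n, D n ×ˢ (univ : Set (Ioo (-a) a))) = univ := by
    rw [← iUnion_prod_const, iUnion_disjointed]
    rw [biUnion_range] at hTc
    rw [hTc, univ_prod_univ]
  have hdisj : Pairwise (Function.onFun Disjoint fun n => D n ×ˢ (univ : Set (Ioo (-a) a))) :=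
    fun i j hij => Disjoint.set_prod_left (disjoint_disjointed _ hij) _ _
  have hDm' : ∀ n, MeasurableSet (D n ×ˢ (univ : Set (Ioo (-a) a))) := fun n =>
    (hDm n).prod MeasurableSet.univ
  rw [← setLIntegral_univ F, ← setLIntegral_univ G, ← hcov, lintegral_iUnion hDm' hdisj,
    lintegral_iUnion hDm' hdisj]
  refine ENNReal.tsum_le_tsum fun n => ?_
  obtain ⟨J, hJ⟩ := H.exists_setLIntegral_layerVolume ha hA (f n)
  have hind : ∀ F : Layer S a → ℝ≥0∞, ∫⁻ z in D n ×ˢ univ, F z ∂H.layerVolume =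
      ∫⁻ z in V (f n) ×ˢ univ, (D n ×ˢ (univ : Set (Ioo (-a) a))).indicator F z
        ∂H.layerVolume := by
    intro F
    rw [setLIntegral_indicator (hDm' n), inter_eq_left.2 (prod_mono (hDs n) le_rfl)]
  rw [hind, hind, hJ _ (hF.indicator (hDm' n)), hJ _ (hG.indicator (hDm' n))]
  refine lintegral_mono fun w => mul_le_mul_right ?_ _
  by_cases hw : (chartAt (EuclideanSpace ℝ (Fin (m - 1))) (f n)).symm w ∈ D n
  · simp only [indicator, mem_prod, hw, mem_univ, and_self, if_true]
    exact hFG _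
  · simp [indicator, mem_prod, hw]

end OrientedHypersurface

/-! ### One-dimensional inequalities from Riccati functions -/

/-- A one-dimensional Hardy type inequality: `∫ (τ' - τ²) f² ≤ ∫ f'²` for every function `f`
vanishing at the end points. -/
theorem intervalIntegral_mul_sq_le_of_riccati {α β : ℝ} (hαβ : α ≤ β) {f f' τ τ' : ℝ → ℝ}
    (hf : ∀ x ∈ Icc α β, HasDerivAt f (f' x) x) (hf' : ContinuousOn f' (Icc α β))
    (hτ : ∀ x ∈ Icc α β, HasDerivAt τ (τ' x) x) (hτ' : ContinuousOn τ' (Icc α β))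
    (hα : f α = 0) (hβ : f β = 0) :
    ∫ x in α..β, (τ' x - τ x ^ 2) * f x ^ 2 ≤ ∫ x in α..β, f' x ^ 2 := by
  have hfc : ContinuousOn f (Icc α β) := fun x hx => (hf x hx).continuousAt.continuousWithinAt
  have hτc : ContinuousOn τ (Icc α β) := fun x hx => (hτ x hx).continuousAt.continuousWithinAt
  have hu : uIcc α β = Icc α β := uIcc_of_le hαβ
  have h1 : ∫ x in α..β, (τ' x * f x ^ 2 + τ x * (2 * f x * f' x)) = 0 := by
    rw [intervalIntegral.integral_eq_sub_of_hasDerivAt (f := fun x => τ x * f x ^ 2)]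
    · simp [hα, hβ]
    · intro x hx
      rw [hu] at hx
      convert! (hτ x hx).mul ((hf x hx).pow 2) using 1
      simp
    · refine ContinuousOn.intervalIntegrable ?_
      rw [hu]; fun_prop
  -- Expanding this square gives the claim up to the integral of `(τ f²)'`, which vanishes with `f`
  -- at the end points.
  have h2 : 0 ≤ ∫ x in α..β, (f' x + τ x * f x) ^ 2 :=
    intervalIntegral.integral_nonneg hαβ fun x _ => sq_nonneg _
  have h3 : ∫ x in α..β, (f' x + τ x * f x) ^ 2 = (∫ x in α..β, f' x ^ 2) -
      (∫ x in α..β, (τ' x - τ x ^ 2) * f x ^ 2) +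
      ∫ x in α..β, (τ' x * f x ^ 2 + τ x * (2 * f x * f' x)) := by
    rw [← intervalIntegral.integral_sub, ← intervalIntegral.integral_add]
    · congr 1; ext x; ring
    all_goals
      refine ContinuousOn.intervalIntegrable ?_
      rw [hu]; fun_prop
  linarith

/-- The Wirtinger inequality on `(-a, a)`. -/
theorem integral_sq_le_integral_deriv_sq {a b : ℝ} (hb : 0 ≤ b) (hba : b < a) {f f' : ℝ → ℝ}
    (hf : ∀ x ∈ Icc (-b) b, HasDerivAt f (f' x) x) (hf' : ContinuousOn f' (Icc (-b) b))
    (h0 : f (-b) = 0) (h1 : f b = 0) :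
    (Real.pi / (2 * a)) ^ 2 * ∫ x in -b..b, f x ^ 2 ≤ ∫ x in -b..b, f' x ^ 2 := by
  have ha : 0 < a := hb.trans_lt hba
  set k := Real.pi / (2 * a) with hk
  have hk0 : 0 < k := by positivity
  have hcos : ∀ x ∈ Icc (-b) b, Real.cos (k * x) ≠ 0 := by
    intro x hx
    have h : k * a = Real.pi / 2 := by rw [hk]; field_simp
    refine (Real.cos_pos_of_mem_Ioo ⟨?_, ?_⟩).ne'
    · nlinarith [hx.1, hx.2]
    · nlinarith [hx.1, hx.2]
  -- `τ = k tan (k x)` is minus the logarithmic derivative of the ground state `cos (k x)` of `(-a,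
  -- a)`, so that `τ' - τ² = k²`. It is regular on `[-b, b]` because `b < a`.
  have := intervalIntegral_mul_sq_le_of_riccati (α := -b) (β := b) (by linarith) hf hf'
    (τ := fun x => k * Real.tan (k * x)) (τ' := fun x => k * (1 / Real.cos (k * x) ^ 2 * k))
    (fun x hx => by
      have h := (Real.hasDerivAt_tan (hcos x hx)).comp x ((hasDerivAt_id x).const_mul k)
      simpa using h.const_mul k) (by
      have : ContinuousOn (fun x => Real.cos (k * x)) (Icc (-b) b) := by fun_prop
      refine continuousOn_const.mul (ContinuousOn.mul (continuousOn_const.div (this.pow 2) ?_)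
        continuousOn_const)
      exact fun x hx => pow_ne_zero 2 (hcos x hx)) h0 h1
  rw [← intervalIntegral.integral_const_mul]
  refine le_of_eq_of_le (intervalIntegral.integral_congr fun x hx => ?_) this
  rw [uIcc_of_le (by linarith)] at hx
  have hc := hcos x hx
  have hs := Real.sin_sq_add_cos_sq (k * x)
  simp only [Real.tan_eq_sin_div_cos]
  congr 1
  field_simp
  linear_combination hs

/-- A Poincaré inequality on an interval of length `δ`. -/
theorem integral_sq_le_of_length {α δ : ℝ} (hδ : 0 < δ) {f f' : ℝ → ℝ}
    (hf : ∀ x ∈ Icc α (α + δ), HasDerivAt f (f' x) x) (hf' : ContinuousOn f' (Icc α (α + δ)))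
    (h0 : f α = 0) (h1 : f (α + δ) = 0) :
    ∫ x in α..(α + δ), f x ^ 2 ≤ 4 * δ ^ 2 * ∫ x in α..(α + δ), f' x ^ 2 := by
  -- A linear `τ` of slope `1 / (2 δ²)` gives `τ' - τ² ≥ 1 / (4 δ²)`. The constant is not sharp;
  -- only its growth as `δ → 0` matters.
  have := intervalIntegral_mul_sq_le_of_riccati (α := α) (β := α + δ) (by linarith) hf hf'
    (τ := fun x => 1 / (2 * δ ^ 2) * (x - α)) (τ' := fun x => 1 / (2 * δ ^ 2) * 1)
    (fun x hx => ((hasDerivAt_id x).sub_const α).const_mul _) (by fun_prop) h0 h1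
  have hfc : ContinuousOn f (Icc α (α + δ)) :=
    fun x hx => (hf x hx).continuousAt.continuousWithinAt
  have h2 : 1 / (4 * δ ^ 2) * ∫ x in α..(α + δ), f x ^ 2 ≤ ∫ x in α..(α + δ), f' x ^ 2 := by
    rw [← intervalIntegral.integral_const_mul]
    refine le_trans (intervalIntegral.integral_mono_on (by linarith) ?_ ?_ fun x hx => ?_) this
    · refine ContinuousOn.intervalIntegrable ?_
      rw [uIcc_of_le (by linarith)]; fun_prop
    · refine ContinuousOn.intervalIntegrable ?_
      rw [uIcc_of_le (by linarith)]; fun_prop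
    · refine mul_le_mul_of_nonneg_right ?_ (sq_nonneg _)
      have h3 : (x - α) ^ 2 ≤ δ ^ 2 := by nlinarith [hx.1, hx.2]
      have : (1 / (2 * δ ^ 2) * (x - α)) ^ 2 ≤ 1 / (4 * δ ^ 2) := by
        rw [mul_pow]
        calc _ ≤ (1 / (2 * δ ^ 2)) ^ 2 * δ ^ 2 := by gcongr
          _ = _ := by field_simp; norm_num
      have h4 : 1 / (2 * δ ^ 2) = 1 / (4 * δ ^ 2) + 1 / (4 * δ ^ 2) := by field_simp; norm_num
      linarith
  rw [div_mul_eq_mul_div, one_mul, div_le_iff₀ (by positivity)] at h2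
  linarith

/-! ### The Laplacian on Euclidean space -/

section Euclidean

variable {E : Type*} [NormedAddCommGroup E] [InnerProductSpace ℝ E]

/-- The Laplacian of a square. -/
theorem laplacian_sq [FiniteDimensional ℝ E] {ι : Type*} [Fintype ι]
    (b : OrthonormalBasis ι ℝ E) {g : E → ℝ} {x : E}
    (hg : ContDiffAt ℝ 2 g x) :
    Laplacian.laplacian (fun y => g y ^ 2) x =
      2 * (g x * Laplacian.laplacian g x) + 2 * ∑ i, fderiv ℝ g x (b i) ^ 2 := by
  have hL : ∀ h : E → ℝ, Laplacian.laplacian h x =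
      ∑ i, fderiv ℝ (fderiv ℝ h) x (b i) (b i) := by
    intro h
    rw [InnerProductSpace.laplacian_eq_iteratedFDeriv_orthonormalBasis h b]
    simp [iteratedFDeriv_two_apply]
  have hev : ∀ᶠ y in 𝓝 x, DifferentiableAt ℝ g y := by
    filter_upwards [hg.eventually (by simp)] with y hy
    exact hy.differentiableAt (by norm_num)
  have h1 : fderiv ℝ (fun y => g y ^ 2) =ᶠ[𝓝 x] fun y => (2 * g y) • fderiv ℝ g y := by
    filter_upwards [hev] with y hy
    rw [fderiv_fun_pow 2 hy]
    simp
  have hd1 : DifferentiableAt ℝ (fderiv ℝ g) x :=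
    (hg.fderiv_right (m := 1) (by norm_num)).differentiableAt (by norm_num)
  have hd0 : DifferentiableAt ℝ g x := hg.differentiableAt (by norm_num)
  rw [hL, hL, h1.fderiv_eq, fderiv_fun_smul (hd0.const_mul 2) hd1, fderiv_const_mul hd0]
  simp only [add_apply, smul_apply, ContinuousLinearMap.smulRight_apply, smul_eq_mul,
    Finset.sum_add_distrib, Finset.mul_sum]
  congr 1
  · exact Finset.sum_congr rfl fun i _ => by ring
  · exact Finset.sum_congr rfl fun i _ => by ring

theorem sq_fderiv_le_sum {ι : Type*} [Fintype ι] (b : OrthonormalBasis ι ℝ E) (L : E →L[ℝ] ℝ)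
    {n : E} (hn : ‖n‖ = 1) : L n ^ 2 ≤ ∑ i, L (b i) ^ 2 := by
  have h1 : L n = ∑ i, inner ℝ (b i) n * L (b i) := by
    conv_lhs => rw [← b.sum_repr' n]
    simp
  have h2 : ∑ i, inner ℝ (b i) n ^ 2 = 1 := by
    have := b.sum_sq_norm_inner_right n
    simpa [hn] using this
  rw [h1]
  refine (Finset.sum_mul_sq_le_sq_mul_sq _ _ _).trans ?_
  rw [h2, one_mul]

/-- The integral of the Laplacian of a compactly supported function vanishes. -/
theorem integral_laplacian_eq_zero [FiniteDimensional ℝ E] [MeasurableSpace E] [BorelSpace E]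
    {g : E → ℝ}
    (hg : ContDiff ℝ 2 g) (hc : HasCompactSupport g) :
    ∫ x, Laplacian.laplacian g x = 0 := by
  set b := stdOrthonormalBasis ℝ E
  have hL : ∀ x, Laplacian.laplacian g x = ∑ i, fderiv ℝ (fun y => fderiv ℝ g y (b i)) x (b i) := by
    intro x
    have hd1 : DifferentiableAt ℝ (fderiv ℝ g) x :=
      (hg.fderiv_right (m := 1) (by norm_num)).differentiable (by norm_num) x
    rw [InnerProductSpace.laplacian_eq_iteratedFDeriv_orthonormalBasis g b]
    simp only [iteratedFDeriv_two_apply]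
    refine Finset.sum_congr rfl fun i _ => ?_
    rw [fderiv_clm_apply hd1 (differentiableAt_const _)]
    simp
  have hd : ∀ i, ContDiff ℝ 1 fun y => fderiv ℝ g y (b i) := fun i =>
    (hg.fderiv_right (m := 1) (by norm_num)).clm_apply contDiff_const
  have hcs : ∀ i, HasCompactSupport fun y => fderiv ℝ g y (b i) := fun i =>
    hc.fderiv_apply ℝ (b i)
  have hcont : ∀ i, Continuous fun x => fderiv ℝ (fun y => fderiv ℝ g y (b i)) x (b i) := fun i =>
    ((hd i).continuous_fderiv (by norm_num)).clm_apply continuous_const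
  have hint : ∀ i, Integrable fun x => fderiv ℝ (fun y => fderiv ℝ g y (b i)) x (b i) := fun i =>
    (hcont i).integrable_of_hasCompactSupport ((hcs i).fderiv_apply ℝ (b i))
  simp only [hL]
  rw [integral_finsetSum _ fun i _ => hint i]
  refine Finset.sum_eq_zero fun i _ => ?_
  have h := integral_mul_fderiv_eq_neg_fderiv_mul_of_integrable (μ := (volume : Measure E))
    (𝕜 := ℝ) (f := fun _ => (1 : ℝ)) (g := fun y => fderiv ℝ g y (b i)) (v := b i)
    (by simp) (by simpa using hint i)
    (by simpa using (hd i).continuous.integrable_of_hasCompactSupport (hcs i))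
    (by intro x _; fun_prop) (fun x _ => (hd i).differentiable (by norm_num) x)
  simpa using h

end Euclidean

/-! ### Smooth functions on the layer -/

namespace OrientedHypersurface

variable {m : ℕ} {S : Type*} [TopologicalSpace S]
  [ChartedSpace (EuclideanSpace ℝ (Fin (m - 1))) S] {H : OrientedHypersurface m S} {a : ℝ}

/-- `Φ` maps neighbourhoods onto neighbourhoods, so the germ of `f` determines that of `g`. This
makes the choice by `Classical.epsilon` in `laplacian` immaterial. -/
theorem IsLocalExpr.eventuallyEq (hloc : IsLocalHomeomorph (H.Φ : Layer S a → _))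
    {f : Layer S a → ℝ} {z : Layer S a} {g g' : EuclideanSpace ℝ (Fin m) → ℝ}
    (h : H.IsLocalExpr f z g) (h' : H.IsLocalExpr f z g') : g =ᶠ[𝓝 (H.Φ z)] g' := by
  rw [← hloc.map_nhds_eq z, EventuallyEq, eventually_map]
  filter_upwards [h.2, h'.2] with y hy hy'
  exact hy.symm.trans hy'

/-- Being `C^∞` at one point is not an open condition, since the neighbourhood may shrink with the
order of differentiability. Smoothness of `f` at the nearby points supplies other local expressions,
with the same germs as `g`. -/
theorem IsLocalExpr.eventually (hloc : IsLocalHomeomorph (H.Φ : Layer S a → _))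
    {f : Layer S a → ℝ} (hf : H.IsSmooth f) {z : Layer S a}
    {g : EuclideanSpace ℝ (Fin m) → ℝ} (h : H.IsLocalExpr f z g) :
    ∀ᶠ y in 𝓝 z, H.IsLocalExpr f y g := by
  filter_upwards [eventually_eventually_nhds.2 h.2] with y hy
  obtain ⟨g', hg', hfg'⟩ := hf y
  refine ⟨hg'.congr_of_eventuallyEq ?_, hy⟩
  rw [← hloc.map_nhds_eq y, EventuallyEq, eventually_map]
  filter_upwards [hy, hfg'] with y' h1 h2
  exact h1.symm.trans h2

theorem IsLocalExpr.laplacian_eq (hloc : IsLocalHomeomorph (H.Φ : Layer S a → _))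
    {f : Layer S a → ℝ} {z : Layer S a} {g : EuclideanSpace ℝ (Fin m) → ℝ}
    (h : H.IsLocalExpr f z g) : H.laplacian f z = Laplacian.laplacian g (H.Φ z) :=
  (InnerProductSpace.laplacian_congr_nhds
    (IsLocalExpr.eventuallyEq hloc (Classical.epsilon_spec ⟨g, h⟩) h)).eq_of_nhds

/-- The differential of a smooth function on the layer, in the coordinates given by `Φ`. -/
def layerFDeriv (H : OrientedHypersurface m S) (f : Layer S a → ℝ) (z : Layer S a) :
    EuclideanSpace ℝ (Fin m) →L[ℝ] ℝ :=
  fderiv ℝ (Classical.epsilon (H.IsLocalExpr f z)) (H.Φ z)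

theorem IsLocalExpr.layerFDeriv_eq (hloc : IsLocalHomeomorph (H.Φ : Layer S a → _))
    {f : Layer S a → ℝ} {z : Layer S a} {g : EuclideanSpace ℝ (Fin m) → ℝ}
    (h : H.IsLocalExpr f z g) : H.layerFDeriv f z = fderiv ℝ g (H.Φ z) :=
  (IsLocalExpr.eventuallyEq hloc (Classical.epsilon_spec ⟨g, h⟩) h).fderiv_eq

theorem IsSmooth.continuous (hloc : IsLocalHomeomorph (H.Φ : Layer S a → _))
    {f : Layer S a → ℝ} (hf : H.IsSmooth f) : Continuous f := by
  refine continuous_iff_continuousAt.2 fun z => ?_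
  obtain ⟨g, hg, hfg⟩ := hf z
  exact (hg.continuousAt.comp hloc.continuous.continuousAt).congr hfg.symm

theorem IsSmooth.continuous_laplacian (hloc : IsLocalHomeomorph (H.Φ : Layer S a → _))
    {f : Layer S a → ℝ} (hf : H.IsSmooth f) : Continuous (H.laplacian f) := by
  refine continuous_iff_continuousAt.2 fun z => ?_
  obtain ⟨g, hg⟩ := hf z
  have h1 : ContinuousAt (Laplacian.laplacian g) (H.Φ z) := by
    have h2 : ContinuousAt (fderiv ℝ (fderiv ℝ g)) (H.Φ z) :=
      ((hg.1.fderiv_right (m := 1) (by decide)).fderiv_right (m := 0) (by decide)).continuousAt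
    rw [InnerProductSpace.laplacian_eq_iteratedFDeriv_stdOrthonormalBasis]
    simp only [iteratedFDeriv_two_apply]
    exact tendsto_finsetSum _ fun i _ =>
      (h2.clm_apply continuousAt_const).clm_apply continuousAt_const
  refine (h1.comp hloc.continuous.continuousAt).congr ?_
  filter_upwards [hg.eventually hloc hf] with y hy
  exact (hy.laplacian_eq hloc).symm

theorem IsSmooth.continuous_layerFDeriv (hloc : IsLocalHomeomorph (H.Φ : Layer S a → _))
    {f : Layer S a → ℝ} (hf : H.IsSmooth f) : Continuous (H.layerFDeriv f) := by
  refine continuous_iff_continuousAt.2 fun z => ?_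
  obtain ⟨g, hg⟩ := hf z
  have h1 : ContinuousAt (fderiv ℝ g) (H.Φ z) :=
    (hg.1.fderiv_right (m := 0) (by decide)).continuousAt
  refine (h1.comp hloc.continuous.continuousAt).congr ?_
  filter_upwards [hg.eventually hloc hf] with y hy
  exact (hy.layerFDeriv_eq hloc).symm

theorem IsLocalExpr.sub {f f' : Layer S a → ℝ} {z : Layer S a}
    {g g' : EuclideanSpace ℝ (Fin m) → ℝ} (h : H.IsLocalExpr f z g) (h' : H.IsLocalExpr f' z g') :
    H.IsLocalExpr (f - f') z (g - g') :=
  ⟨h.1.sub h'.1, h.2.sub h'.2⟩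

theorem IsLocalExpr.mul {f f' : Layer S a → ℝ} {z : Layer S a}
    {g g' : EuclideanSpace ℝ (Fin m) → ℝ} (h : H.IsLocalExpr f z g) (h' : H.IsLocalExpr f' z g') :
    H.IsLocalExpr (f * f') z (g * g') :=
  ⟨h.1.mul h'.1, h.2.mul h'.2⟩

theorem IsSmooth.sub {f f' : Layer S a → ℝ} (hf : H.IsSmooth f) (hf' : H.IsSmooth f') :
    H.IsSmooth (f - f') := fun z =>
  let ⟨_, hg⟩ := hf z
  let ⟨_, hg'⟩ := hf' z
  ⟨_, hg.sub hg'⟩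

theorem IsSmooth.mul {f f' : Layer S a → ℝ} (hf : H.IsSmooth f) (hf' : H.IsSmooth f') :
    H.IsSmooth (f * f') := fun z =>
  let ⟨_, hg⟩ := hf z
  let ⟨_, hg'⟩ := hf' z
  ⟨_, hg.mul hg'⟩

theorem laplacian_sub (hloc : IsLocalHomeomorph (H.Φ : Layer S a → _))
    {f f' : Layer S a → ℝ} (hf : H.IsSmooth f) (hf' : H.IsSmooth f') (z : Layer S a) :
    H.laplacian (f - f') z = H.laplacian f z - H.laplacian f' z := by
  obtain ⟨g, hg⟩ := hf z
  obtain ⟨g', hg'⟩ := hf' z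
  rw [(hg.sub hg').laplacian_eq hloc, hg.laplacian_eq hloc, hg'.laplacian_eq hloc]
  exact (hg.1.of_le (by decide)).laplacian_sub (hg'.1.of_le (by decide))

theorem isLocalExpr_zero_of_notMem_tsupport {f : Layer S a → ℝ} {z : Layer S a}
    (hz : z ∉ tsupport f) : H.IsLocalExpr f z 0 :=
  ⟨contDiffAt_const, notMem_tsupport_iff_eventuallyEq.1 hz⟩

theorem hasCompactSupport_laplacian (hloc : IsLocalHomeomorph (H.Φ : Layer S a → _))
    {f : Layer S a → ℝ} (hf : HasCompactSupport f) : HasCompactSupport (H.laplacian f) := by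
  refine hf.mono' fun z hz => ?_
  by_contra h
  apply hz
  rw [(isLocalExpr_zero_of_notMem_tsupport h).laplacian_eq hloc]
  have := InnerProductSpace.laplacian_const (E := EuclideanSpace ℝ (Fin m)) (c := (0 : ℝ))
  exact congrFun this _

theorem layerFDeriv_eq_zero (hloc : IsLocalHomeomorph (H.Φ : Layer S a → _))
    {f : Layer S a → ℝ} {z : Layer S a} (hz : z ∉ tsupport f) : H.layerFDeriv f z = 0 := by
  rw [(isLocalExpr_zero_of_notMem_tsupport hz).layerFDeriv_eq hloc]
  exact fderiv_const_apply 0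

theorem isSmooth_of_eqOn {f : Layer S a → ℝ} {K V : Set (Layer S a)} (hK : IsClosed K)
    (hV : IsOpen V) (hKV : K ⊆ V) {g : EuclideanSpace ℝ (Fin m) → ℝ} (hg : ContDiff ℝ ∞ g)
    (h : EqOn f (g ∘ H.Φ) V) (h0 : ∀ z ∉ K, f z = 0) : H.IsSmooth f := by
  intro z
  by_cases hz : z ∈ K
  · exact ⟨g, hg.contDiffAt, h.eventuallyEq_of_mem (hV.mem_nhds (hKV hz))⟩
  · refine ⟨0, contDiffAt_const, ?_⟩
    filter_upwards [hK.isOpen_compl.mem_nhds hz] with y hy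
    exact h0 y hy

/-- Smooth cut-off functions on the layer. -/
theorem exists_isSmooth_bump [T2Space S] (e : OpenPartialHomeomorph (Layer S a)
    (EuclideanSpace ℝ (Fin m))) (he : H.Φ = e) {z : Layer S a} (hz : z ∈ e.source) :
    ∃ b : Layer S a → ℝ, H.IsSmooth b ∧ HasCompactSupport b ∧ tsupport b ⊆ e.source ∧
      ∀ᶠ y in 𝓝 z, b y = 1 := by
  classical
  obtain ⟨r, hr, hrt⟩ := Metric.nhds_basis_closedBall.mem_iff.1
    (e.open_target.mem_nhds (e.map_source hz))
  let ψ : ContDiffBump (e z) := ⟨r / 2, r, by positivity, by linarith⟩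
  set K := e.symm '' Metric.closedBall (e z) r with hK
  have hKc : IsCompact K := (isCompact_closedBall _ _).image_of_continuousOn
    (e.continuousOn_symm.mono hrt)
  have hKs : K ⊆ e.source := by
    rintro _ ⟨y, hy, rfl⟩
    exact e.map_target (hrt hy)
  set b : Layer S a → ℝ := fun y => if y ∈ e.source then ψ (e y) else 0 with hb
  have h0 : ∀ y ∉ K, b y = 0 := by
    intro y hy
    simp only [hb]
    split_ifs with hys
    · refine ψ.zero_of_le_dist ?_
      by_contra hlt
      exact hy ⟨e y, (not_le.1 hlt).le, e.left_inv hys⟩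
    · rfl
  have hsupp : tsupport b ⊆ K := closure_minimal
    (fun y hy => by_contra fun h => hy (h0 y h)) hKc.isClosed
  refine ⟨b, isSmooth_of_eqOn hKc.isClosed e.open_source hKs ψ.contDiff ?_ h0,
    HasCompactSupport.intro hKc h0, hsupp.trans hKs, ?_⟩
  · intro y hy
    simp [hb, hy, he]
  · have h1 : ∀ᶠ y in 𝓝 z, ψ (e y) = 1 :=
      (e.continuousAt hz).eventually ψ.eventuallyEq_one
    filter_upwards [h1, e.open_source.mem_nhds hz] with y hy hys
    simp [hb, hys, hy]

end OrientedHypersurface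

/-! ### Integration by parts on the layer -/

namespace OrientedHypersurface

variable {m : ℕ} {S : Type*} [TopologicalSpace S]
  [ChartedSpace (EuclideanSpace ℝ (Fin (m - 1))) S] {H : OrientedHypersurface m S} {a : ℝ}
  [SecondCountableTopology S] [MeasurableSpace S] [BorelSpace S]

theorem map_restrict_layerVolume (hloc : IsLocalHomeomorph (H.Φ : Layer S a → _))
    (e : OpenPartialHomeomorph (Layer S a) (EuclideanSpace ℝ (Fin m))) (he : H.Φ = e) :
    (H.layerVolume.restrict e.source).map H.Φ = volume.restrict e.target := by
  refine Measure.ext fun B hB => ?_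
  have hinj : InjOn H.Φ e.source := he ▸ e.injOn
  have hΦB : MeasurableSet (H.Φ ⁻¹' B : Set (Layer S a)) := hloc.continuous.measurable hB
  rw [Measure.map_apply hloc.continuous.measurable hB, Measure.restrict_apply hΦB,
    Measure.restrict_apply hB, H.layerVolume_apply hloc e.open_source hinj
      (hΦB.inter e.open_source.measurableSet) inter_subset_right, inter_comm, he,
    e.image_source_inter_eq', inter_comm]
  congr 1
  ext y
  simp only [mem_inter_iff, mem_preimage]
  constructor
  · rintro ⟨h1, h2⟩; exact ⟨by rwa [e.right_inv h2] at h1, h2⟩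
  · rintro ⟨h1, h2⟩; exact ⟨by rwa [e.right_inv h2], h2⟩

/-- When the support lies in one domain of injectivity, `f` becomes, after extension by zero, a
compactly supported smooth function on Euclidean space. -/
theorem integral_laplacian_eq_zero_of_tsupport_subset
    (hloc : IsLocalHomeomorph (H.Φ : Layer S a → _))
    (e : OpenPartialHomeomorph (Layer S a) (EuclideanSpace ℝ (Fin m))) (he : H.Φ = e)
    {f : Layer S a → ℝ} (hf : H.IsSmooth f) (hc : HasCompactSupport f)
    (hfe : tsupport f ⊆ e.source) : ∫ z, H.laplacian f z ∂H.layerVolume = 0 := by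
  classical
  set K := e '' tsupport f with hK
  have hKc : IsCompact K := hc.isCompact.image_of_continuousOn (e.continuousOn.mono hfe)
  have hKt : K ⊆ e.target := by
    rintro _ ⟨z, hz, rfl⟩
    exact e.map_source (hfe hz)
  set g : EuclideanSpace ℝ (Fin m) → ℝ := fun y => if y ∈ e.target then f (e.symm y) else 0
    with hg
  have hg0 : ∀ y ∉ K, g y = 0 := by
    intro y hy
    simp only [hg]
    split_ifs with hyt
    · refine image_eq_zero_of_notMem_tsupport fun h => hy ⟨_, h, e.right_inv hyt⟩
    · rfl
  have hgs : ContDiff ℝ ∞ g := by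
    refine contDiff_iff_contDiffAt.2 fun y => ?_
    by_cases hy : y ∈ K
    · have hyt := hKt hy
      obtain ⟨g', hg', hfg'⟩ := hf (e.symm y)
      rw [he, e.right_inv hyt] at hg'
      refine hg'.congr_of_eventuallyEq ?_
      filter_upwards [(e.continuousAt_symm hyt).eventually hfg', e.open_target.mem_nhds hyt]
        with w hw hwt
      simp only [hg, if_pos hwt]
      rw [hw, Function.comp_apply, he, e.right_inv hwt]
    · refine contDiffAt_const (c := (0 : ℝ)) |>.congr_of_eventuallyEq ?_
      filter_upwards [hKc.isClosed.isOpen_compl.mem_nhds hy] with w hw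
      exact hg0 w hw
  have hgc : HasCompactSupport g := HasCompactSupport.intro hKc hg0
  have hlap : ∀ z ∈ e.source, H.laplacian f z = Laplacian.laplacian g (H.Φ z) := by
    intro z hz
    refine IsLocalExpr.laplacian_eq hloc ⟨hgs.contDiffAt, ?_⟩
    filter_upwards [e.open_source.mem_nhds hz] with w hw
    simp only [Function.comp_apply, hg, he, if_pos (e.map_source hw), e.left_inv hw]
  have hlap0 : ∀ y ∉ K, Laplacian.laplacian g y = 0 := by
    intro y hy
    have h1 : g =ᶠ[𝓝 y] fun _ => (0 : ℝ) := by
      filter_upwards [hKc.isClosed.isOpen_compl.mem_nhds hy] with w hw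
      exact hg0 w hw
    rw [(InnerProductSpace.laplacian_congr_nhds h1).eq_of_nhds]
    exact congrFun (InnerProductSpace.laplacian_const (E := EuclideanSpace ℝ (Fin m))
      (c := (0 : ℝ))) _
  have hgl : Continuous (Laplacian.laplacian g) := by
    have h2 : Continuous (fderiv ℝ (fderiv ℝ g)) :=
      ((hgs.fderiv_right (m := 1) (by decide)).fderiv_right (m := 0) (by decide)).continuous
    rw [InnerProductSpace.laplacian_eq_iteratedFDeriv_stdOrthonormalBasis]
    simp only [iteratedFDeriv_two_apply]
    exact continuous_finsetSum _ fun i _ =>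
      (h2.clm_apply continuous_const).clm_apply continuous_const
  have h1 : ∀ z ∉ e.source, H.laplacian f z = 0 := by
    intro z hz
    rw [(isLocalExpr_zero_of_notMem_tsupport fun h => hz (hfe h)).laplacian_eq hloc]
    exact congrFun (InnerProductSpace.laplacian_const (E := EuclideanSpace ℝ (Fin m))
      (c := (0 : ℝ))) _
  rw [← setIntegral_eq_integral_of_forall_compl_eq_zero h1,
    setIntegral_congr_fun e.open_source.measurableSet hlap,
    ← integral_map (φ := H.Φ) hloc.continuous.measurable.aemeasurable
      hgl.aestronglyMeasurable, map_restrict_layerVolume hloc e he,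
    setIntegral_eq_integral_of_forall_compl_eq_zero fun y hy => hlap0 y fun h => hy (hKt h)]
  exact integral_laplacian_eq_zero (hgs.of_le (by decide)) hgc

theorem integrable_layerVolume (hloc : IsLocalHomeomorph (H.Φ : Layer S a → _))
    {f : Layer S a → ℝ} (hf : Continuous f) (hc : HasCompactSupport f) :
    Integrable f H.layerVolume :=
  have := H.isLocallyFiniteMeasure_layerVolume hloc
  hf.integrable_of_hasCompactSupport hc

variable [T2Space S]

/-- The integral of the Laplacian of a smooth function with compact support vanishes. -/
theorem integral_laplacian_layerVolume (hloc : IsLocalHomeomorph (H.Φ : Layer S a → _))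
    {f : Layer S a → ℝ} (hf : H.IsSmooth f) (hc : HasCompactSupport f) :
    ∫ z, H.laplacian f z ∂H.layerVolume = 0 := by
  choose e hze he using id hloc
  choose b hbs hbc hbe hb1 using fun z => exists_isSmooth_bump (e z) (he z) (hze z)
  -- Induction on the number of bumps replaces a partition of unity: `f * b i` lives in one domain,
  -- and `f - f * b i` vanishes wherever `b i = 1`, so the remaining bumps suffice for it.
  have key : ∀ (t : Finset (Layer S a)) (f : Layer S a → ℝ), H.IsSmooth f →
      HasCompactSupport f → (∀ z, f z ≠ 0 → ∃ i ∈ t, b i z = 1) →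
      ∫ z, H.laplacian f z ∂H.layerVolume = 0 := by
    classical
    intro t
    induction t using Finset.induction with
    | empty =>
      intro f hf hc h
      have hf0 : f = 0 := funext fun z => by_contra fun hz => by simpa using h z hz
      rw [← integral_zero (Layer S a) ℝ (μ := H.layerVolume)]
      congr 1
      funext z
      rw [(isLocalExpr_zero_of_notMem_tsupport (f := f) (z := z)
        (by simp [hf0, tsupport])).laplacian_eq hloc]
      exact congrFun (InnerProductSpace.laplacian_const (E := EuclideanSpace ℝ (Fin m))
        (c := (0 : ℝ))) _
    | insert i t hi ih =>
      intro f hf hc h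
      have hs := hf.mul (hbs i)
      have hsc : HasCompactSupport (f * b i) := hc.mul_right
      have h1 := ih (f - f * b i) (hf.sub hs) (hc.sub hsc) fun z hz => by
        have hz1 : f z ≠ 0 := fun h0 => hz (by simp [h0])
        have hz2 : b i z ≠ 1 := fun h0 => hz (by simp [h0])
        obtain ⟨j, hj, hjz⟩ := h z hz1
        rcases Finset.mem_insert.1 hj with rfl | hj
        · exact absurd hjz hz2
        · exact ⟨j, hj, hjz⟩
      have h2 := integral_laplacian_eq_zero_of_tsupport_subset hloc (e i) (he i) hs hsc
        ((closure_mono (Function.support_mul_subset_right _ _)).trans (hbe i))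
      simp only [laplacian_sub hloc hf hs] at h1
      rwa [integral_sub (integrable_layerVolume hloc (hf.continuous_laplacian hloc)
          (hasCompactSupport_laplacian hloc hc))
        (integrable_layerVolume hloc (hs.continuous_laplacian hloc)
          (hasCompactSupport_laplacian hloc hsc)), h2, sub_zero] at h1
  obtain ⟨t, -, ht⟩ := hc.isCompact.elim_nhds_subcover (fun z => {y | b z y = 1})
    fun z _ => hb1 z
  refine key t f hf hc fun z hz => ?_
  obtain ⟨i, hi, hiz⟩ := mem_iUnion₂.1 (ht (subset_tsupport f hz))
  exact ⟨i, hi, hiz⟩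

/-- The energy of a test function dominates that of its derivative in the normal direction. -/
theorem integral_sq_layerFDeriv_le (hloc : IsLocalHomeomorph (H.Φ : Layer S a → _))
    {f : Layer S a → ℝ} (hf : H.IsSmooth f) (hc : HasCompactSupport f)
    (hν : Continuous H.ν) :
    ∫ z, H.layerFDeriv f z (H.ν z.1) ^ 2 ∂H.layerVolume ≤
      - ∫ z, f z * H.laplacian f z ∂H.layerVolume := by
  set b := stdOrthonormalBasis ℝ (EuclideanSpace ℝ (Fin m))
  -- Integrating `Δ(f²) = 2 f Δf + 2 |∇f|²`, whose left side has integral zero, identifies the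
  -- energy with `∫ |∇f|²`.
  have hsq : ∀ z, H.laplacian (f * f) z =
      2 * (f z * H.laplacian f z) + 2 * ∑ i, H.layerFDeriv f z (b i) ^ 2 := by
    intro z
    obtain ⟨g, hg⟩ := hf z
    rw [(hg.mul hg).laplacian_eq hloc, hg.laplacian_eq hloc, hg.layerFDeriv_eq hloc,
      hg.2.eq_of_nhds, Function.comp_apply, ← laplacian_sq b (hg.1.of_le (by decide)),
      show g * g = fun y => g y ^ 2 from funext fun y => (sq _).symm]
  have hD := hf.continuous_layerFDeriv hloc
  have hcont : Continuous fun z => ∑ i, H.layerFDeriv f z (b i) ^ 2 :=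
    continuous_finsetSum _ fun i _ => (hD.clm_apply continuous_const).pow 2
  have hsupp : ∀ z ∉ tsupport f, H.layerFDeriv f z = 0 := fun z hz => layerFDeriv_eq_zero hloc hz
  have i1 : Integrable (fun z => f z * H.laplacian f z) H.layerVolume :=
    integrable_layerVolume hloc ((hf.continuous hloc).mul (hf.continuous_laplacian hloc))
      hc.mul_right
  have i2 : Integrable (fun z => ∑ i, H.layerFDeriv f z (b i) ^ 2) H.layerVolume :=
    integrable_layerVolume hloc hcont (HasCompactSupport.intro hc.isCompact fun z hz => by
      simp [hsupp z hz])
  have i3 : Integrable (fun z => H.layerFDeriv f z (H.ν z.1) ^ 2) H.layerVolume :=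
    integrable_layerVolume hloc ((hD.clm_apply (hν.comp continuous_fst)).pow 2)
      (HasCompactSupport.intro hc.isCompact fun z hz => by simp [hsupp z hz])
  have h0 := integral_laplacian_layerVolume hloc (hf.mul hf) hc.mul_right
  simp only [hsq] at h0
  rw [integral_add (i1.const_mul 2) (i2.const_mul 2), integral_const_mul, integral_const_mul] at h0
  have h1 : ∫ z, H.layerFDeriv f z (H.ν z.1) ^ 2 ∂H.layerVolume ≤
      ∫ z, ∑ i, H.layerFDeriv f z (b i) ^ 2 ∂H.layerVolume :=
    integral_mono i3 i2 fun z => sq_fderiv_le_sum b _ (H.norm_ν z.1)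
  linarith

end OrientedHypersurface

/-! ### Weighted inequalities for functions on a fibre -/

section OneDimensional

variable {a b c : ℝ}

theorem support_subset_Ioc_of_le_abs {f : ℝ → ℝ} (hf : ∀ t, b ≤ |t| → f t = 0) :
    Function.support f ⊆ Ioc (-b) b := by
  intro t ht
  have h : |t| < b := by
    by_contra h
    exact ht (hf t (not_lt.1 h))
  exact ⟨(abs_lt.1 h).1, (abs_lt.1 h).2.le⟩

theorem hasCompactSupport_of_le_abs {f : ℝ → ℝ} (hf : ∀ t, b ≤ |t| → f t = 0) :
    HasCompactSupport f :=
  HasCompactSupport.intro (isCompact_Icc (a := -b) (b := b)) fun t ht => by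
    by_contra h
    exact ht (Ioc_subset_Icc_self (support_subset_Ioc_of_le_abs hf h))

theorem lintegral_Ioo_ofReal (hba : b < a) {f : ℝ → ℝ} (hf : Continuous f) (h0 : ∀ t, 0 ≤ f t)
    (hb : ∀ t, b ≤ |t| → f t = 0) :
    ∫⁻ u : Ioo (-a) a, ENNReal.ofReal (f u) ∂((volume : Measure ℝ).comap Subtype.val) =
      ENNReal.ofReal (∫ t, f t) := by
  rw [lintegral_subtype_comap measurableSet_Ioo fun t => ENNReal.ofReal (f t),
    ofReal_integral_eq_lintegral_ofReal
      (hf.integrable_of_hasCompactSupport (hasCompactSupport_of_le_abs hb))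
      (Eventually.of_forall h0), ← lintegral_indicator measurableSet_Ioo]
  congr 1
  funext t
  by_cases ht : t ∈ Ioo (-a) a
  · rw [indicator_of_mem ht]
  · rw [indicator_of_notMem ht, hb t, ENNReal.ofReal_zero]
    by_contra h
    exact ht (abs_lt.1 ((not_le.1 h).trans hba))

/-- `f` is a function of class `C¹` on the line with derivative `f'`, which vanishes outside
`(-b, b)`. -/
structure IsProfile (b : ℝ) (f f' : ℝ → ℝ) : Prop where
  hasDerivAt : ∀ t, HasDerivAt f (f' t) t
  continuous_deriv : Continuous f'
  eq_zero : ∀ t, b ≤ |t| → f t = 0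
  deriv_eq_zero : ∀ t, b ≤ |t| → f' t = 0

namespace IsProfile

variable {f f' : ℝ → ℝ}

theorem continuous (h : IsProfile b f f') : Continuous f :=
  continuous_iff_continuousAt.2 fun t => (h.hasDerivAt t).continuousAt

theorem integral_eq (h : IsProfile b f f') {w : ℝ → ℝ} (hbc : b ≤ c) :
    ∫ t, w t * f t ^ 2 = ∫ t in -c..c, w t * f t ^ 2 :=
  (intervalIntegral.integral_eq_integral_of_support_subset (support_subset_Ioc_of_le_abs
    fun t ht => by simp [h.eq_zero t (hbc.trans ht)])).symm

theorem integral_deriv_eq (h : IsProfile b f f') {w : ℝ → ℝ} (hbc : b ≤ c) :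
    ∫ t, w t * f' t ^ 2 = ∫ t in -c..c, w t * f' t ^ 2 :=
  (intervalIntegral.integral_eq_integral_of_support_subset (support_subset_Ioc_of_le_abs
    fun t ht => by simp [h.deriv_eq_zero t (hbc.trans ht)])).symm

/-- The Riccati function for the constant of `(-a, a)` is singular at `± a`; hence the passage to
`[-b, b]`, outside which `f` and `f'` vanish. -/
theorem wirtinger (h : IsProfile b f f') (hb : 0 ≤ b) (hba : b < a) :
    (Real.pi / (2 * a)) ^ 2 * ∫ t in -a..a, f t ^ 2 ≤ ∫ t in -a..a, f' t ^ 2 := by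
  have h1 := h.integral_eq (w := 1) hba.le
  have h2 := h.integral_eq (w := 1) le_rfl
  have h3 := h.integral_deriv_eq (w := 1) hba.le
  have h4 := h.integral_deriv_eq (w := 1) le_rfl
  simp only [Pi.one_apply, one_mul] at h1 h2 h3 h4
  rw [← h1, ← h3, h2, h4]
  exact integral_sq_le_integral_deriv_sq hb hba (fun t _ => h.hasDerivAt t)
    h.continuous_deriv.continuousOn (h.eq_zero _ (by simp [abs_of_nonneg hb]))
    (h.eq_zero _ (by simp [abs_of_nonneg hb]))

/-- Only the two end intervals of length `δ` contribute to `∫ f²`, and `f` vanishes at both ends of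
each. -/
theorem integral_sq_le_of_eq_zero (h : IsProfile b f f') {δ : ℝ} (hba : b < a)
    (hδ : 0 < δ) (hδa : δ ≤ a)
    (h0 : ∀ t, |t| ≤ a - δ → f t = 0) :
    1 / (4 * δ ^ 2) * ∫ t in -a..a, f t ^ 2 ≤ ∫ t in -a..a, f' t ^ 2 := by
  have ha : 0 < a := hδ.trans_le hδa
  have i1 : ∀ s t, IntervalIntegrable (fun t => f t ^ 2) volume s t :=
    fun s t => (h.continuous.pow 2).intervalIntegrable s t
  have i2 : ∀ s t, IntervalIntegrable (fun t => f' t ^ 2) volume s t :=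
    fun s t => (h.continuous_deriv.pow 2).intervalIntegrable s t
  rw [← intervalIntegral.integral_add_adjacent_intervals (i1 (-a) (-a + δ)) (i1 _ a),
    ← intervalIntegral.integral_add_adjacent_intervals (i1 (-a + δ) (a - δ)) (i1 _ a),
    ← intervalIntegral.integral_add_adjacent_intervals (i2 (-a) (-a + δ)) (i2 _ a),
    ← intervalIntegral.integral_add_adjacent_intervals (i2 (-a + δ) (a - δ)) (i2 _ a)]
  have hle : -a + δ ≤ a - δ := by linarith
  have e1 : ∫ t in (-a + δ)..(a - δ), f t ^ 2 = 0 := by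
    rw [intervalIntegral.integral_congr (g := fun _ => (0 : ℝ)), intervalIntegral.integral_zero]
    intro t ht
    rw [uIcc_of_le hle] at ht
    simp [h0 t (abs_le.2 ⟨by linarith [ht.1], ht.2⟩)]
  have e2 : 0 ≤ ∫ t in (-a + δ)..(a - δ), f' t ^ 2 :=
    intervalIntegral.integral_nonneg hle fun t _ => sq_nonneg _
  have e3 := integral_sq_le_of_length (α := -a) hδ (fun t _ => h.hasDerivAt t)
    h.continuous_deriv.continuousOn (h.eq_zero _ (by rw [abs_neg, abs_of_pos ha]; exact hba.le))
    (h0 _ (by rw [abs_le]; constructor <;> linarith))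
  have e4 := integral_sq_le_of_length (α := a - δ) hδ (fun t _ => h.hasDerivAt t)
    h.continuous_deriv.continuousOn (h0 _ (by rw [abs_le]; constructor <;> linarith))
    (h.eq_zero _ (by rw [sub_add_cancel, abs_of_pos ha]; exact hba.le))
  rw [sub_add_cancel] at e4
  rw [e1, zero_add, one_div_mul_eq_div, div_le_iff₀ (by positivity)]
  nlinarith [mul_nonneg (sq_nonneg δ) e2]

/-- A weight between `α` and `β` costs at most the factor `β / α` in the constant; `hμ` says that
`μ` can afford it. -/
theorem weighted_lintegral_le (h : IsProfile b f f') {w : ℝ → ℝ} (hw : Continuous w) {α β μ l : ℝ}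
    (hba : b < a) (ha : 0 < a) (hα : 0 ≤ α) (hl : 0 ≤ l)
    (hwα : ∀ t, |t| ≤ a → α ≤ w t) (hwβ : ∀ t, |t| ≤ a → w t ≤ β) (hw0 : ∀ t, 0 ≤ w t)
    (hμ : l * β ≤ μ * α)
    (hle : μ * ∫ t in -a..a, f t ^ 2 ≤ ∫ t in -a..a, f' t ^ 2) :
    ∫⁻ u : Ioo (-a) a, ENNReal.ofReal (w u) * ENNReal.ofReal (l * f u ^ 2)
        ∂((volume : Measure ℝ).comap Subtype.val) ≤
      ∫⁻ u : Ioo (-a) a, ENNReal.ofReal (w u) * ENNReal.ofReal (f' u ^ 2)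
        ∂((volume : Measure ℝ).comap Subtype.val) := by
  simp only [← ENNReal.ofReal_mul (hw0 _)]
  rw [lintegral_Ioo_ofReal hba (f := fun t => w t * (l * f t ^ 2))
      (hw.mul (continuous_const.mul (h.continuous.pow 2)))
      (fun t => mul_nonneg (hw0 t) (by positivity)) (fun t ht => by simp [h.eq_zero t ht]),
    lintegral_Ioo_ofReal hba (f := fun t => w t * f' t ^ 2) (hw.mul (h.continuous_deriv.pow 2))
      (fun t => mul_nonneg (hw0 t) (sq_nonneg _)) (fun t ht => by simp [h.deriv_eq_zero t ht])]
  refine ENNReal.ofReal_le_ofReal ?_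
  have hab : -a ≤ a := by linarith
  have hI : 0 ≤ ∫ t in -a..a, f t ^ 2 :=
    intervalIntegral.integral_nonneg hab fun t _ => sq_nonneg _
  have hc : Continuous fun t => w t * f t ^ 2 := hw.mul (h.continuous.pow 2)
  have hc' : Continuous fun t => w t * f' t ^ 2 := hw.mul (h.continuous_deriv.pow 2)
  have h1 : ∫ t, w t * (l * f t ^ 2) = l * ∫ t in -a..a, w t * f t ^ 2 := by
    rw [← h.integral_eq hba.le, ← integral_const_mul]
    exact integral_congr_ae (Eventually.of_forall fun t => by ring)
  rw [h1, h.integral_deriv_eq hba.le]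
  have h2 : ∫ t in -a..a, w t * f t ^ 2 ≤ β * ∫ t in -a..a, f t ^ 2 := by
    rw [← intervalIntegral.integral_const_mul]
    refine intervalIntegral.integral_mono_on hab (hc.intervalIntegrable _ _)
      ((continuous_const.mul (h.continuous.pow 2)).intervalIntegrable _ _) fun t ht => ?_
    exact mul_le_mul_of_nonneg_right (hwβ t (abs_le.2 ht)) (sq_nonneg _)
  have h3 : α * ∫ t in -a..a, f' t ^ 2 ≤ ∫ t in -a..a, w t * f' t ^ 2 := by
    rw [← intervalIntegral.integral_const_mul]
    refine intervalIntegral.integral_mono_on hab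
      ((continuous_const.mul (h.continuous_deriv.pow 2)).intervalIntegrable _ _)
      (hc'.intervalIntegrable _ _) fun t ht => ?_
    exact mul_le_mul_of_nonneg_right (hwα t (abs_le.2 ht)) (sq_nonneg _)
  calc l * ∫ t in -a..a, w t * f t ^ 2 ≤ l * (β * ∫ t in -a..a, f t ^ 2) :=
        mul_le_mul_of_nonneg_left h2 hl
    _ = (l * β) * ∫ t in -a..a, f t ^ 2 := by ring
    _ ≤ (μ * α) * ∫ t in -a..a, f t ^ 2 := mul_le_mul_of_nonneg_right hμ hI
    _ = α * (μ * ∫ t in -a..a, f t ^ 2) := by ring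
    _ ≤ α * ∫ t in -a..a, f' t ^ 2 := mul_le_mul_of_nonneg_left hle hα
    _ ≤ _ := h3

end IsProfile

end OneDimensional

/-! ### Test functions restricted to fibres -/

namespace OrientedHypersurface

variable {m : ℕ} {S : Type*} [TopologicalSpace S]
  [ChartedSpace (EuclideanSpace ℝ (Fin (m - 1))) S] {H : OrientedHypersurface m S} {a : ℝ}

/-- The restriction of a test function to a fibre of the layer. -/
theorem exists_isProfile (hloc : IsLocalHomeomorph (H.Φ : Layer S a → _)) (ha : 0 < a)
    {f : Layer S a → ℝ} (hf : H.IsSmooth f) (hc : HasCompactSupport f) (x : S) :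
    ∃ (b : ℝ) (f₀ f₁ : ℝ → ℝ), 0 ≤ b ∧ b < a ∧ IsProfile b f₀ f₁ ∧ ∀ u : Ioo (-a) a,
      f₀ u = f (x, u) ∧ f₁ u = H.layerFDeriv f (x, u) (H.ν x) := by
  classical
  -- The point `0` only makes `K` nonempty, so that `|t|` has a maximum on it, which is less than
  -- `a`.
  set K : Set ℝ := insert 0 ((fun z : Layer S a => (z.2 : ℝ)) '' tsupport f) with hK
  have hKc : IsCompact K :=
    (hc.isCompact.image (continuous_subtype_val.comp continuous_snd)).insert 0
  have hKI : ∀ t ∈ K, |t| < a := by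
    rintro t (rfl | ⟨z, -, rfl⟩)
    · simpa using ha
    · exact abs_lt.2 z.2.2
  obtain ⟨c, hcK, hcmax⟩ := hKc.exists_isMaxOn ⟨0, mem_insert _ _⟩ continuous_abs.continuousOn
  obtain ⟨b, hcb, hba⟩ := exists_between (hKI c hcK)
  have hbK : ∀ t, b ≤ |t| → t ∉ K := fun t ht htK => by
    have := hcmax htK
    exact (hcb.trans_le ht).not_ge this
  set f₀ : ℝ → ℝ := fun t => if h : t ∈ Ioo (-a) a then f (x, ⟨t, h⟩) else 0 with hf₀
  set f₁ : ℝ → ℝ := fun t =>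
    if h : t ∈ Ioo (-a) a then H.layerFDeriv f (x, ⟨t, h⟩) (H.ν x) else 0 with hf₁
  have e0 : ∀ u : Ioo (-a) a, f₀ u = f (x, u) := fun u => by simp only [hf₀, dif_pos u.2]
  have e1 : ∀ u : Ioo (-a) a, f₁ u = H.layerFDeriv f (x, u) (H.ν x) := fun u => by
    simp only [hf₁, dif_pos u.2]
  have hz : ∀ t (h : t ∈ Ioo (-a) a), t ∉ K → (x, (⟨t, h⟩ : Ioo (-a) a)) ∉ tsupport f :=
    fun t h ht h' => ht (mem_insert_of_mem _ ⟨_, h', rfl⟩)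
  have z0 : ∀ t ∉ K, f₀ t = 0 := fun t ht => by
    simp only [hf₀]
    split_ifs with h
    · exact image_eq_zero_of_notMem_tsupport (hz t h ht)
    · rfl
  have z1 : ∀ t ∉ K, f₁ t = 0 := fun t ht => by
    simp only [hf₁]
    split_ifs with h
    · rw [layerFDeriv_eq_zero hloc (hz t h ht)]; rfl
    · rfl
  have hnhds : ∀ u : Ioo (-a) a, 𝓝 (u : ℝ) = map Subtype.val (𝓝 u) := fun u =>
    (isOpen_Ioo.isOpenEmbedding_subtypeVal.map_nhds_eq u).symm
  have hev : ∀ t ∉ K, ∀ᶠ s in 𝓝 t, s ∉ K := fun t ht => hKc.isClosed.isOpen_compl.mem_nhds ht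
  refine ⟨b, f₀, f₁, (abs_nonneg c).trans hcb.le, hba, ⟨?_, ?_, fun t ht => z0 t (hbK t ht),
    fun t ht => z1 t (hbK t ht)⟩, fun u => ⟨e0 u, e1 u⟩⟩
  · intro t
    by_cases ht : t ∈ K
    · lift t to Ioo (-a) a using abs_lt.1 (hKI t ht)
      obtain ⟨g, hg⟩ := hf (x, t)
      -- On a fibre `Φ` is affine with velocity `ν`, so a local expression of `f` is differentiated
      -- along a line.
      have h1 : f₀ =ᶠ[𝓝 (t : ℝ)] fun s => g (H.p x + s • H.ν x) := by
        rw [hnhds, EventuallyEq, eventually_map]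
        have : Tendsto (fun u : Ioo (-a) a => (x, u)) (𝓝 t) (𝓝 (x, t)) :=
          (Continuous.prodMk_right x).continuousAt
        filter_upwards [this.eventually hg.2] with u hu
        rw [e0, hu]
        rfl
      have h2 : HasDerivAt (fun s : ℝ => H.p x + s • H.ν x) (H.ν x) (t : ℝ) := by
        simpa using ((hasDerivAt_id (t : ℝ)).smul_const (H.ν x)).const_add (H.p x)
      have h3 : HasFDerivAt g (fderiv ℝ g (H.Φ (x, t))) (H.p x + (t : ℝ) • H.ν x) :=
        (hg.1.differentiableAt (by decide)).hasFDerivAt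
      rw [e1, hg.layerFDeriv_eq hloc]
      exact (h3.comp_hasDerivAt (t : ℝ) h2).congr_of_eventuallyEq h1
    · rw [z1 t ht]
      refine (hasDerivAt_const t (0 : ℝ)).congr_of_eventuallyEq ?_
      filter_upwards [hev t ht] with s hs using z0 s hs
  · refine continuous_iff_continuousAt.2 fun t => ?_
    by_cases ht : t ∈ K
    · lift t to Ioo (-a) a using abs_lt.1 (hKI t ht)
      rw [ContinuousAt, hnhds, tendsto_map'_iff, e1]
      have : Continuous fun u : Ioo (-a) a => H.layerFDeriv f (x, u) (H.ν x) :=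
        ((hf.continuous_layerFDeriv hloc).comp (Continuous.prodMk_right x)).clm_apply
          continuous_const
      rw [show f₁ ∘ Subtype.val = _ from funext e1]
      exact this.continuousAt
    · refine (continuousAt_const (y := (0 : ℝ))).congr ?_
      filter_upwards [hev t ht] with s hs using (z1 s hs).symm

end OrientedHypersurface

/-! ### The compact set and the bound for the Rayleigh quotient -/

namespace OrientedHypersurface

variable {m : ℕ} {S : Type*} [TopologicalSpace S]
  [ChartedSpace (EuclideanSpace ℝ (Fin (m - 1))) S] {H : OrientedHypersurface m S} {a : ℝ}

theorem isCompact_setOf_abs_le (a : ℝ) {δ : ℝ} (hδ : 0 < δ) {C : Set S} (hC : IsCompact C) :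
    IsCompact {z : Layer S a | z.1 ∈ C ∧ |(z.2 : ℝ)| ≤ a - δ} := by
  have h1 : IsCompact ((↑) ⁻¹' Icc (-(a - δ)) (a - δ) : Set (Ioo (-a) a)) := by
    rw [IsInducing.subtypeVal.isCompact_preimage_iff]
    · exact isCompact_Icc
    · rw [Subtype.range_coe]
      exact fun t ht => ⟨by linarith [ht.1], by linarith [ht.2]⟩
  convert hC.prod h1 using 1
  ext z
  simp [abs_le]

variable [IsManifold (𝓡 (m - 1)) 2 S]

theorem continuous_density_fibre (x : S) : Continuous fun t : ℝ => H.density x t :=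
  H.continuous_density.comp (Continuous.prodMk_right x)

/-- For every constant below that of the interval `(-a, a)`, the weighted one-dimensional
inequality holds on all fibres for the test functions supported outside a suitable compact set. -/
theorem exists_isCompact_forall_fibre [T2Space S] (hcomplete : H.IsComplete) (ha : 0 < a)
    (hA : H.BoundedWidth a) {x₀ : S} (hflat : H.AsymptoticallyFlat x₀) {l : ℝ} (hl : 0 < l)
    (hlt : l < (Real.pi / (2 * a)) ^ 2) :
    ∃ K : Set (Layer S a), IsCompact K ∧ ∀ f ∈ H.testFunctions K, ∀ x : S,
      ∫⁻ u : Ioo (-a) a, ENNReal.ofReal (H.density x u) * ENNReal.ofReal (l * f (x, u) ^ 2)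
          ∂((volume : Measure ℝ).comap Subtype.val) ≤
        ∫⁻ u : Ioo (-a) a, ENNReal.ofReal (H.density x u) *
          ENNReal.ofReal (H.layerFDeriv f (x, u) (H.ν x) ^ 2)
          ∂((volume : Measure ℝ).comap Subtype.val) := by
  have hloc := H.isLocalHomeomorph_Φ ha hA
  set k := (Real.pi / (2 * a)) ^ 2 with hk
  -- The solution of `l (1 + ε) = k (1 - ε)`: the largest deviation of the density from `1` that
  -- lowers `k` to no less than `l`.
  set ε := (k - l) / (k + l) with hε
  have hkl : 0 < k + l := by linarith
  have hε0 : 0 < ε := div_pos (by linarith) hkl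
  have hε1 : ε ≤ 1 := (div_le_one hkl).2 (by linarith)
  have hεl : l * (1 + ε) ≤ k * (1 - ε) := by
    rw [hε]
    apply le_of_eq
    field_simp
    ring
  obtain ⟨η, hη, hdens⟩ := exists_density_near_one (m := m) (S := S) a hε0
  obtain ⟨R, hR⟩ := hflat η hη
  obtain ⟨C, hC, hRC⟩ := H.exists_isCompact_dist_le hcomplete x₀ R
  obtain ⟨c₁, c₂, hc₁, hc₂, hc⟩ := H.exists_density_bounds hA hC
  -- Since `δ ≤ 1`, also `δ² ≤ c₁ / (4 l c₂)`, which lets the Poincaré constant `1 / (4 δ²)` absorb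
  -- the density ratio `c₂ / c₁`.
  set δ := min a (min 1 (c₁ / (4 * l * c₂))) with hδ
  have hδ0 : 0 < δ := lt_min ha (lt_min one_pos (by positivity))
  have hδa : δ ≤ a := min_le_left _ _
  have hδc : l * c₂ ≤ 1 / (4 * δ ^ 2) * c₁ := by
    have h1 : δ ≤ 1 := (min_le_right _ _).trans (min_le_left _ _)
    have h2 : δ ≤ c₁ / (4 * l * c₂) := (min_le_right _ _).trans (min_le_right _ _)
    rw [le_div_iff₀ (by positivity)] at h2
    rw [one_div_mul_eq_div, le_div_iff₀ (by positivity)]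
    nlinarith [mul_nonneg (mul_pos (mul_pos hl hc₂) hδ0).le (sub_nonneg.2 h1)]
  refine ⟨_, isCompact_setOf_abs_le a hδ0 hC, fun f hf x => ?_⟩
  obtain ⟨hfs, hfc, hfK⟩ := hf
  obtain ⟨b, f₀, f₁, hb0, hba, hp, hfib⟩ := exists_isProfile hloc ha hfs hfc x
  simp only [← (hfib _).1, ← (hfib _).2]
  by_cases hx : x ∈ C
  · refine hp.weighted_lintegral_le (continuous_density_fibre x) hba ha hc₁.le hl.le
      (fun t ht => (hc x hx t ht).1) (fun t ht => (hc x hx t ht).2) (H.density_nonneg x) hδc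
      (hp.integral_sq_le_of_eq_zero hba hδ0 hδa fun t ht => ?_)
    have hta : t ∈ Ioo (-a) a := abs_lt.1 (by linarith)
    rw [(hfib ⟨t, hta⟩).1]
    exact image_eq_zero_of_notMem_tsupport fun h => hfK h ⟨hx, ht⟩
  · have hxη : H.normA x < η := hR x (not_le.1 fun h => hx (hRC x h))
    exact hp.weighted_lintegral_le (continuous_density_fibre x) hba ha (sub_nonneg.2 hε1) hl.le
      (fun t ht => by linarith [(abs_le.1 (hdens H x hxη t ht)).1])
      (fun t ht => by linarith [(abs_le.1 (hdens H x hxη t ht)).2]) (H.density_nonneg x) hεl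
      (hp.wirtinger hb0 hba)

variable [SecondCountableTopology S] [MeasurableSpace S] [BorelSpace S] [T2Space S]

/-- The fibre inequalities integrate to `l ∫ f² ≤ ∫ (∂f/∂u)²`, and the right side is at most the
energy. The volume is positive on nonempty open sets, so the denominator is not zero. -/
theorem exists_isCompact_forall_le_rayleigh (hcomplete : H.IsComplete) (ha : 0 < a)
    (hA : H.BoundedWidth a) {x₀ : S} (hflat : H.AsymptoticallyFlat x₀) {l : ℝ} (hl : 0 < l)
    (hlt : l < (Real.pi / (2 * a)) ^ 2) :
    ∃ K : Set (Layer S a), IsCompact K ∧ ∀ f ∈ H.testFunctions K, f ≠ 0 → l ≤ H.rayleigh f := by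
  have hloc := H.isLocalHomeomorph_Φ ha hA
  obtain ⟨K, hK, hfib⟩ := exists_isCompact_forall_fibre hcomplete ha hA hflat hl hlt
  refine ⟨K, hK, fun f hf hf0 => ?_⟩
  obtain ⟨hfs, hfc, -⟩ := id hf
  have := H.isLocallyFiniteMeasure_layerVolume hloc
  have := H.isOpenPosMeasure_layerVolume hloc
  have hcont := hfs.continuous hloc
  have hν : Continuous H.ν := H.contMDiff_ν.continuous
  have hDc : Continuous fun z : Layer S a => H.layerFDeriv f z (H.ν z.1) ^ 2 :=
    ((hfs.continuous_layerFDeriv hloc).clm_apply (hν.comp continuous_fst)).pow 2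
  have hDi : Integrable (fun z : Layer S a => H.layerFDeriv f z (H.ν z.1) ^ 2) H.layerVolume :=
    integrable_layerVolume hloc hDc (HasCompactSupport.intro hfc.isCompact fun z hz => by
      simp [layerFDeriv_eq_zero hloc hz])
  have hsc : HasCompactSupport fun z => f z ^ 2 :=
    HasCompactSupport.intro hfc.isCompact fun z hz => by
      simp [image_eq_zero_of_notMem_tsupport hz]
  have hfi : Integrable (fun z => f z ^ 2) H.layerVolume :=
    integrable_layerVolume hloc (hcont.pow 2) hsc
  have hpos : 0 < ∫ z, f z ^ 2 ∂H.layerVolume := by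
    obtain ⟨z, hz⟩ := Function.ne_iff.1 hf0
    exact (hcont.pow 2).integral_pos_of_hasCompactSupport_nonneg_nonzero hsc
      (fun z => sq_nonneg _) (pow_ne_zero 2 hz)
  have h1 := H.lintegral_layerVolume_mono ha hA
    (F := fun z => ENNReal.ofReal (l * f z ^ 2))
    (continuous_const.mul (hcont.pow 2)).measurable.ennreal_ofReal
    hDc.measurable.ennreal_ofReal (hfib f hf)
  rw [← ofReal_integral_eq_lintegral_ofReal (hfi.const_mul l)
      (Eventually.of_forall fun z => mul_nonneg hl.le (sq_nonneg _)),
    ← ofReal_integral_eq_lintegral_ofReal hDi (Eventually.of_forall fun z => sq_nonneg _),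
    ENNReal.ofReal_le_ofReal_iff (integral_nonneg fun z => sq_nonneg _), integral_const_mul] at h1
  rw [rayleigh, le_div_iff₀ hpos]
  exact h1.trans (integral_sq_layerFDeriv_le hloc hfs hfc hν)

end OrientedHypersurface

end

theorem theorem2 {m : ℕ} (hm : 3 ≤ m) {S : Type*} [TopologicalSpace S] [T2Space S]
    [SecondCountableTopology S] [ChartedSpace (EuclideanSpace ℝ (Fin (m - 1))) S]
    [IsManifold (𝓡 (m - 1)) 2 S] [MeasurableSpace S] [BorelSpace S]
    (H : OrientedHypersurface m S) (hcomplete : H.IsComplete)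
    {a : ℝ} (ha : 0 < a) (hA2 : H.BoundedWidth a)
    (x₀ : S) (hA3 : H.AsymptoticallyFlat x₀) :
    (((Real.pi / (2 * a)) ^ 2 : ℝ) : EReal) ≤ H.σess a := by
  refine le_of_forall_lt fun c hc => ?_
  -- The given bound may be negative or `-∞`; the fibre estimate needs `l > 0`, hence the maximum
  -- with `0`.
  obtain ⟨l, hcl, hl⟩ := EReal.lt_iff_exists_real_btwn.1
    (max_lt hc (EReal.coe_pos.2 (by positivity : 0 < (Real.pi / (2 * a)) ^ 2)))
  obtain ⟨K, hK, hKl⟩ := OrientedHypersurface.exists_isCompact_forall_le_rayleigh hcomplete ha hA2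
    hA3 (EReal.coe_pos.1 ((le_max_right _ _).trans_lt hcl)) (EReal.coe_lt_coe_iff.1 hl)
  refine ((le_max_left _ _).trans_lt hcl).trans_le (le_trans ?_ (le_iSup₂ K hK))
  exact le_iInf₂ fun f hf => EReal.coe_le_coe_iff.2 (hKl f hf.1 hf.2)
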